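/- Setting. Let $\rho$ be a probability measure on a measurable space $\Xi$ and let $(\psi_j)_{j\in\iota}$ be measurable real functions that are orthonormal in $L^2(\rho)$. A basis is a finite set $\mathcal B\subset\iota$. Put $\|\psi_{\mathcal B}(\xi)\|_2=(\sum_{j\in\mathcal B}\psi_j(\xi)^2)^{1/2}$, let $g_{\mathcal B}(\xi)=|\mathcal B|^{-1}\|\psi_{\mathcal B}(\xi)\|_2^2$ be the coherence-optimal density of $\mathcal B$ relative to $\rho$, and let $w_{\mathcal B}(\xi)=\sqrt{|\mathcal B|}\,\|\psi_{\mathcal B}(\xi)\|_2^{-1}$ (and $0$ where $\psi_{\mathcal B}(\xi)=0$) be its weight. Let $\mathcal B$ (previous basis) and $\mathcal B'$ (current basis) be two bases, let $N_1,N_2\ge1$, $N=N_1+N_2$, $\alpha=N_2/N$, and define the correction density $g^c$ by $$(1-\alpha)\,g_{\mathcal B}+\alpha\, g^c=g_{\mathcal B'} ,$$ where it is assumed that $g^c\ge0$ $\rho$-a.e. Let $X_1,\dots,X_{N_1}$ be independent samples with density $g_{\mathcal B}$ and $Y_1,\dots,Y_{N_2}$ independent samples with density $g^c$ relative to $\rho$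 (no independence between the two groups is needed). Let $\mathcal S\subseteq\mathcal B'$ with $|\mathcal S|\ge2$. The design matrix $D_{\mathcal S}=\binom{D_{\mathcal S,1}}{D_{\mathcal S,2}}$ has columns indexed by $j\in\mathcal S$ and blocks $$(D_{\mathcal S,1})_{ij}=N^{-1/2}w_{\mathcal B'}(X_i)\psi_j(X_i),\qquad (D_{\mathcal S,2})_{ij}=N^{-1/2}w_{\mathcal B'}(Y_i)\psi_j(Y_i).$$ Let $E_{\mathcal S,i}=\mathbb E(D_{\mathcal S,i}^TD_{\mathcal S,i})$ for $i=1,2$. Let $\mu_1$ and $\mu_2$ be the coherences $$\mu_i=\operatorname*{ess\,sup}_{\xi\sim\nu_i}\ \max_{T\subseteq\mathcal B',\,|T|\le|\mathcal S|}\ \sum_{k\in T}|w_{\mathcal B'}(\xi)\psi_k(\xi)|^2,$$ where $\nu_1$ and $\nu_2$ have densities $g_{\mathcal B}$ and $g^c$ relative to $\rho$. Norms of matrices are $\ell_2$ operator norms. Claim. For every $t_0>0$ there is a function $\kappa:\mathbb R\to(0,\infty)$, depending on nothing but $t_0$, such that in every such setting and for every $t\ge t_0$, with $\kappa_i=\kappa\big(\|E_{\mathcal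 S,i}\|^{-1/2}\big)$ (where $0^{-1/2}$ is read as $0$), $$\mathbb P\big(\|D_{\mathcal S}^TD_{\mathcal S}-I\|>t\big)\le|\mathcal S|\min_{\tau_1+\tau_2=t}\Big(\exp\big(-\kappa_1\tau_1N_1\mu_1^{-1}\big)+\exp\big(-\kappa_2\tau_2N_2\mu_2^{-1}\big)\Big),$$ where the minimum over all real $\tau_1,\tau_2$ with $\tau_1+\tau_2=t$ is attained. -/

import Mathlib

open MeasureTheory ProbabilityTheory
open scoped Matrix Matrix.Norms.L2Operator

noncomputable section

namespace BasePC

variable {Ξ ι : Type*}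

/-- The Euclidean norm `‖ψ(ξ)‖₂` of the row vector of the basis functions in `B` at `ξ`. -/
def rowNorm (ψ : ι → Ξ → ℝ) (B : Finset ι) (ξ : Ξ) : ℝ :=
  √(∑ j ∈ B, ψ j ξ ^ 2)

/-- The coherence-optimal density `|B|⁻¹ ‖ψ(ξ)‖₂²` of the basis `B`, relative to the
orthogonality distribution. -/
def optDensity (ψ : ι → Ξ → ℝ) (B : Finset ι) (ξ : Ξ) : ℝ :=
  (B.card : ℝ)⁻¹ * rowNorm ψ B ξ ^ 2

/-- The weight function `w(ξ) = √|B| ‖ψ(ξ)‖₂⁻¹` that belongs to the coherence-optimal density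
of `B`. -/
def weight (ψ : ι → Ξ → ℝ) (B : Finset ι) (ξ : Ξ) : ℝ :=
  √(B.card : ℝ) * (rowNorm ψ B ξ)⁻¹

/-- The fraction `α` of correction samples among all samples. -/
def corrRatio (N₁ N₂ : ℕ) : ℝ := (N₂ : ℝ) / ((N₁ : ℝ) + (N₂ : ℝ))

/-- The correction density `gᶜ` from the basis `B` to the basis `B'`: the solution of
`(1 - α) g_B + α gᶜ = g_{B'}`. -/
def corrDensity (ψ : ι → Ξ → ℝ) (B B' : Finset ι) (α : ℝ) (ξ : Ξ) : ℝ :=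
  (optDensity ψ B' ξ - (1 - α) * optDensity ψ B ξ) / α

/-- The distribution with density `g` relative to `ρ`. -/
def samplingLaw [MeasurableSpace Ξ] (ρ : Measure Ξ) (g : Ξ → ℝ) : Measure Ξ :=
  ρ.withDensity (fun ξ => ENNReal.ofReal (g ξ))

/-- The coherence `μ₂(s)` of the basis `B` for samples with distribution `ν`: the essential
maximum over `ξ` of the maximum over subsets `T` of `B` with `|T| ≤ s` of
`∑_{k ∈ T} |w(ξ) ψ_k(ξ)|²`. -/
def coherence [MeasurableSpace Ξ] (ν : Measure Ξ) (ψ : ι → Ξ → ℝ) (B : Finset ι) (s : ℕ) : ℝ :=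
  essSup (fun ξ => (B.powerset.filter (fun T => T.card ≤ s)).sup' ⟨∅, by simp⟩
    (fun T => ∑ k ∈ T, |weight ψ B ξ * ψ k ξ| ^ 2)) ν

/-- The block of the design matrix of the basis `B`, restricted to the columns in `S`, given by
the sample points `x`. Here `N` is the number of all samples, over which the design matrix
is normalized. -/
def designMatrix (ψ : ι → Ξ → ℝ) (B S : Finset ι) (N : ℕ) {n : ℕ} (x : Fin n → Ξ) :
    Matrix (Fin n) S ℝ :=
  Matrix.of fun i j => (√(N : ℝ))⁻¹ * (weight ψ B (x i) * ψ j (x i))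

/-- The entrywise expectation of a random matrix. -/
def expectation {Ω m n : Type*} [MeasurableSpace Ω] (P : Measure Ω) (A : Ω → Matrix m n ℝ) :
    Matrix m n ℝ :=
  Matrix.of fun i j => ∫ ω, A ω i j ∂P

end BasePC

end

/-! The Gram matrix of block `i` is a sum of `N_i` independent copies of `v vᵀ`, where almost surely
`|v|² ≤ R = μ_i / N`. The defining mixture of `gᶜ` and the cancellation of the weight against the
optimal density of `B'` give `E₁ + E₂ = 1`. Both summands are positive semidefinite, so each is at
most `1`. With `M = E_i / N_i` the centered summand has second moment at most `R • M ≤ R / N_i`.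

The Ahlswede–Winter method turns this into a Bernstein bound. Golden–Thompson (`trace_exp_add_le`)
peels independent factors off the trace of the exponential, `exp A ≤ 1 + A + A²` bounds each factor,
and Markov's inequality concludes (`measureReal_lt_norm_sum_le`). Hence block `i` deviates from
`E_i` by more than `t / 2` with probability at most `2 |S| exp (-4 c_i t)`, where `c_i = κ N_i /
μ_i`.

For the right-hand side, every split `τ₁ + τ₂ = t`, even with a negative part, gives a sum of at
least `exp (-min c₁ c₂ * t)` (`exp_neg_le_exp_add_exp`). A union bound over the blocks therefore
suffices, once the prefactor `4 |S|` is reduced to `|S|`; the spare factor 4 in the exponent and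
`|S| ≥ 2` pay for that (`le_mul_of_le_mul_pow_four`). Only `E_i ≤ 1` enters, so `κ` can be a
constant function. -/

set_option linter.unusedSectionVars false

/-! ### The Lie product formula in a Banach algebra. -/

section LieTrotter

open Filter Topology NormedSpace

variable {𝔸 : Type*} [NormedRing 𝔸] [NormedAlgebra ℝ 𝔸] [CompleteSpace 𝔸]

/-- A normed real algebra is a normed rational algebra. -/
abbrev NormedAlgebra.ratOfReal (𝔸 : Type*) [NormedRing 𝔸] [NormedAlgebra ℝ 𝔸] [Algebra ℚ 𝔸] :
    NormedAlgebra ℚ 𝔸 where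
  norm_smul_le r x := by rw [← Rat.cast_smul_eq_qsmul ℝ, norm_smul]; simp

/-- Assuming `‖1‖ ≤ 1` instead of equality admits matrices over an empty index type, where `1 = 0`.
-/
theorem norm_pow_le_of_norm_one_le (h1 : ‖(1 : 𝔸)‖ ≤ 1) (A : 𝔸) (k : ℕ) : ‖A ^ k‖ ≤ ‖A‖ ^ k := by
  rcases Nat.eq_zero_or_pos k with rfl | hk
  · simpa using h1
  · exact norm_pow_le' A hk

theorem norm_exp_le_exp_norm [Algebra ℚ 𝔸] (h1 : ‖(1 : 𝔸)‖ ≤ 1) (A : 𝔸) :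
    ‖exp A‖ ≤ Real.exp ‖A‖ := by
  rw [Real.exp_eq_exp_ℝ, exp_eq_tsum ℝ, exp_eq_tsum ℝ]
  refine tsum_of_norm_bounded (expSeries_summable' (𝕂 := ℝ) ‖A‖).hasSum fun k => ?_
  rw [norm_smul, smul_eq_mul, Real.norm_of_nonneg (by positivity)]
  gcongr
  exact norm_pow_le_of_norm_one_le h1 A k

theorem norm_pow_sub_pow_le (h1 : ‖(1 : 𝔸)‖ ≤ 1) {X Y : 𝔸} {K : ℝ} (hX : ‖X‖ ≤ K) (hY : ‖Y‖ ≤ K)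
    (hK : 1 ≤ K) (m : ℕ) : ‖X ^ m - Y ^ m‖ ≤ m * K ^ m * ‖X - Y‖ := by
  induction m with
  | zero => simp
  | succ m ih =>
    have hK0 : 0 ≤ K := by linarith
    have hsplit : X ^ (m + 1) - Y ^ (m + 1) = X ^ m * (X - Y) + (X ^ m - Y ^ m) * Y := by
      rw [pow_succ, pow_succ]; noncomm_ring
    have hXm : ‖X ^ m‖ ≤ K ^ (m + 1) :=
      (norm_pow_le_of_norm_one_le h1 X m).trans
        ((pow_le_pow_left₀ (norm_nonneg _) hX m).trans (pow_le_pow_right₀ hK (Nat.le_succ m)))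
    calc ‖X ^ (m + 1) - Y ^ (m + 1)‖
        ≤ ‖X ^ m‖ * ‖X - Y‖ + ‖X ^ m - Y ^ m‖ * ‖Y‖ := by
          rw [hsplit]
          exact (norm_add_le _ _).trans (add_le_add (norm_mul_le _ _) (norm_mul_le _ _))
      _ ≤ K ^ (m + 1) * ‖X - Y‖ + (m * K ^ m * ‖X - Y‖) * K := by gcongr
      _ = ((m + 1 : ℕ) : ℝ) * K ^ (m + 1) * ‖X - Y‖ := by push_cast; ring

/-- The Lie product formula. -/
theorem tendsto_exp_mul_exp_pow (h1 : ‖(1 : 𝔸)‖ ≤ 1) [Algebra ℚ 𝔸] (A B : 𝔸) :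
    Tendsto (fun m : ℕ => (exp ((m : ℝ)⁻¹ • A) * exp ((m : ℝ)⁻¹ • B)) ^ m) atTop
      (𝓝 (exp (A + B))) := by
  -- The two sides agree to first order at `0`, so `m • f (1 / m) → 0`. The power difference bound
  -- with `K = exp (c / m)` costs only the factor `m * K ^ m = m * exp c`.
  set f : ℝ → 𝔸 := fun t => exp (t • A) * exp (t • B) - exp (t • (A + B)) with hf
  have hder : HasDerivAt f 0 0 := by
    have hA := hasDerivAt_exp_smul_const (𝕂 := ℝ) A (0 : ℝ)
    have hB := hasDerivAt_exp_smul_const (𝕂 := ℝ) B (0 : ℝ)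
    have hAB := hasDerivAt_exp_smul_const (𝕂 := ℝ) (A + B) (0 : ℝ)
    have h := (hA.mul hB).sub hAB
    simp only [zero_smul, exp_zero, one_mul, mul_one, sub_self] at h
    exact h
  have hf0 : f 0 = 0 := by simp [hf]
  have hslope : Tendsto (fun m : ℕ => (m : ℝ) • f ((m : ℝ)⁻¹)) atTop (𝓝 0) := by
    have h := hasDerivAt_iff_tendsto_slope_zero.mp hder
    have hm : Tendsto (fun m : ℕ => (m : ℝ)⁻¹) atTop (𝓝[≠] 0) := by
      refine tendsto_nhdsWithin_iff.mpr ⟨tendsto_inv_atTop_nhds_zero_nat, ?_⟩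
      filter_upwards [eventually_gt_atTop 0] with m hm
      simp; omega
    simpa [hf0, Function.comp_def] using h.comp hm
  set c : ℝ := ‖A‖ + ‖B‖ with hc
  have hc0 : 0 ≤ c := by positivity
  have hlim : Tendsto (fun m : ℕ => Real.exp c * ‖(m : ℝ) • f ((m : ℝ)⁻¹)‖) atTop (𝓝 0) := by
    simpa using (hslope.norm.const_mul (Real.exp c))
  rw [tendsto_iff_norm_sub_tendsto_zero]
  refine squeeze_zero' (Eventually.of_forall fun _ => norm_nonneg _) ?_ hlim
  filter_upwards [eventually_gt_atTop 0] with m hm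
  have hm' : (0 : ℝ) < m := by exact_mod_cast hm
  have hYm : exp (A + B) = exp ((m : ℝ)⁻¹ • (A + B)) ^ m := by
    let := NormedAlgebra.ratOfReal 𝔸
    rw [← exp_nsmul, ← Nat.cast_smul_eq_nsmul ℝ, smul_smul, mul_inv_cancel₀ hm'.ne', one_smul]
  have hbound : ∀ C : 𝔸, ‖(m : ℝ)⁻¹ • C‖ = (m : ℝ)⁻¹ * ‖C‖ := fun C => by
    rw [norm_smul, Real.norm_of_nonneg (by positivity)]
  have hX : ‖exp ((m : ℝ)⁻¹ • A) * exp ((m : ℝ)⁻¹ • B)‖ ≤ Real.exp ((m : ℝ)⁻¹ * c) := by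
    refine (norm_mul_le _ _).trans ?_
    rw [hc, mul_add, Real.exp_add, ← hbound, ← hbound]
    gcongr <;> exact norm_exp_le_exp_norm h1 _
  have hY : ‖exp ((m : ℝ)⁻¹ • (A + B))‖ ≤ Real.exp ((m : ℝ)⁻¹ * c) := by
    refine (norm_exp_le_exp_norm h1 _).trans (Real.exp_le_exp.mpr ?_)
    rw [hbound]
    gcongr
    exact norm_add_le _ _
  have hmain := norm_pow_sub_pow_le h1 hX hY (Real.one_le_exp (by positivity)) m
  rw [← hYm] at hmain
  refine hmain.trans_eq ?_
  rw [← Real.exp_nat_mul, ← mul_assoc, mul_inv_cancel₀ hm'.ne', one_mul, norm_smul,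
    Real.norm_of_nonneg hm'.le]
  ring

end LieTrotter

/-! ### Trace inequalities of Weyl and Golden–Thompson. -/

section GoldenThompson

open Filter Topology Matrix

variable {n : Type*} [Fintype n] [DecidableEq n]

theorem abs_trace_mul_le_sqrt (A B : Matrix n n ℝ) :
    |(A * B).trace| ≤ √((Aᵀ * A).trace) * √((Bᵀ * B).trace) := by
  have key : ∀ C : Matrix n n ℝ, (Cᵀ * C).trace = ∑ p : n × n, C p.2 p.1 ^ 2 := fun C => by
    simp [Matrix.trace, Matrix.mul_apply, Fintype.sum_prod_type, sq]
  have h2 : (A * B).trace = ∑ p : n × n, A p.2 p.1 * B p.1 p.2 := by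
    simp only [Matrix.trace, Matrix.diag_apply, Matrix.mul_apply, Fintype.sum_prod_type]
    exact Finset.sum_comm
  have hB : (Bᵀ * B).trace = ∑ p : n × n, B p.1 p.2 ^ 2 := by
    rw [key, Fintype.sum_prod_type, Fintype.sum_prod_type, Finset.sum_comm]
  rw [h2, key A, hB, ← Real.sqrt_mul (Finset.sum_nonneg fun _ _ => sq_nonneg _)]
  exact Real.abs_le_sqrt (Finset.sum_mul_sq_le_sq_mul_sq _ _ _)

theorem trace_transpose_mul_self_nonneg (A : Matrix n n ℝ) : 0 ≤ (Aᵀ * A).trace := by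
  simp only [Matrix.trace, Matrix.diag_apply, Matrix.mul_apply, Matrix.transpose_apply]
  exact Finset.sum_nonneg fun _ _ => Finset.sum_nonneg fun _ _ => mul_self_nonneg _

theorem abs_trace_sq_le (M : Matrix n n ℝ) : |(M * M).trace| ≤ (Mᵀ * M).trace := by
  have h := abs_trace_mul_le_sqrt M M
  rwa [Real.mul_self_sqrt (trace_transpose_mul_self_nonneg M)] at h

/-- Weyl's inequality and the Golden–Thompson inequality for powers of two,
proved by a joint induction. -/
theorem trace_pow_two_pow_le (k : ℕ) :
    (∀ M : Matrix n n ℝ, |(M ^ 2 ^ (k + 1)).trace| ≤ ((Mᵀ * M) ^ 2 ^ k).trace) ∧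
    (∀ P Q : Matrix n n ℝ, Pᵀ = P → Qᵀ = Q →
      ((P * Q) ^ 2 ^ k).trace ≤ (P ^ 2 ^ k * Q ^ 2 ^ k).trace) := by
  induction k with
  | zero =>
    refine ⟨fun M => ?_, fun P Q _ _ => by simp⟩
    simpa [pow_two] using abs_trace_sq_le M
  | succ k ih =>
    have hsymm : ∀ {P : Matrix n n ℝ}, Pᵀ = P → ∀ j, (P ^ j)ᵀ = P ^ j := fun h j => by
      rw [transpose_pow, h]
    -- Apply the induction hypothesis for Weyl to `M²`, rotate under the trace to `(M Mᵀ)(Mᵀ M)`,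
    -- separate the powers by the other induction hypothesis, and finish with Cauchy–Schwarz, as `M
    -- Mᵀ` and `Mᵀ M` have equal power traces.
    have weyl : ∀ M : Matrix n n ℝ,
        |(M ^ 2 ^ (k + 2)).trace| ≤ ((Mᵀ * M) ^ 2 ^ (k + 1)).trace := by
      intro M
      have hP : (M * Mᵀ)ᵀ = M * Mᵀ := by simp
      have hQ : (Mᵀ * M)ᵀ = Mᵀ * M := by simp
      have e1 : M ^ 2 ^ (k + 2) = (M * M) ^ 2 ^ (k + 1) := by
        rw [← pow_two, ← pow_mul, ← pow_succ']
      have e2 : (((M * M)ᵀ * (M * M)) ^ 2 ^ k).trace = (((M * Mᵀ) * (Mᵀ * M)) ^ 2 ^ k).trace := by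
        obtain ⟨j, hj⟩ : ∃ j, 2 ^ k = j + 1 :=
          ⟨2 ^ k - 1, (Nat.sub_add_cancel Nat.one_le_two_pow).symm⟩
        have e3 : ∀ X Y : Matrix n n ℝ, ((X * Y) ^ (j + 1)).trace = ((Y * X) ^ (j + 1)).trace := by
          intro X Y
          have : ∀ i : ℕ, (X * Y) ^ (i + 1) = X * (Y * X) ^ i * Y := by
            intro i
            induction i with
            | zero => simp
            | succ i ih => rw [pow_succ, ih, pow_succ]; simp only [mul_assoc]
          rw [this, Matrix.trace_mul_comm, ← mul_assoc, ← pow_succ']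
        have e4 : (M * M)ᵀ * (M * M) = Mᵀ * (Mᵀ * M * M) := by
          rw [transpose_mul]; simp only [mul_assoc]
        rw [hj, e4, e3]
        rw [show Mᵀ * M * M * Mᵀ = (Mᵀ * M) * (M * Mᵀ) by simp only [mul_assoc], e3]
      have cs := abs_trace_mul_le_sqrt ((M * Mᵀ) ^ 2 ^ k) ((Mᵀ * M) ^ 2 ^ k)
      rw [hsymm hP, hsymm hQ, ← pow_add, ← pow_add, ← two_mul, ← pow_succ'] at cs
      have e5 : ((M * Mᵀ) ^ 2 ^ (k + 1)).trace = ((Mᵀ * M) ^ 2 ^ (k + 1)).trace := by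
        obtain ⟨j, hj⟩ : ∃ j, 2 ^ (k + 1) = j + 1 :=
          ⟨2 ^ (k + 1) - 1, (Nat.sub_add_cancel Nat.one_le_two_pow).symm⟩
        have : ∀ i : ℕ, (M * Mᵀ) ^ (i + 1) = M * (Mᵀ * M) ^ i * Mᵀ := by
          intro i
          induction i with
          | zero => simp
          | succ i ih => rw [pow_succ, ih, pow_succ]; simp only [mul_assoc]
        rw [hj, this, Matrix.trace_mul_comm, ← mul_assoc, ← pow_succ']
      have hnn : 0 ≤ ((Mᵀ * M) ^ 2 ^ (k + 1)).trace := by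
        have h := trace_transpose_mul_self_nonneg ((Mᵀ * M) ^ 2 ^ k)
        rwa [hsymm hQ, ← pow_add, ← two_mul, ← pow_succ'] at h
      rw [e5, Real.mul_self_sqrt hnn] at cs
      rw [e1]
      calc |((M * M) ^ 2 ^ (k + 1)).trace| ≤ (((M * M)ᵀ * (M * M)) ^ 2 ^ k).trace := ih.1 _
        _ = (((M * Mᵀ) * (Mᵀ * M)) ^ 2 ^ k).trace := e2
        _ ≤ ((M * Mᵀ) ^ 2 ^ k * (Mᵀ * M) ^ 2 ^ k).trace := ih.2 _ _ hP hQ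
        _ ≤ _ := (le_abs_self _).trans cs
    refine ⟨weyl, fun P Q hP hQ => ?_⟩
    -- Weyl replaces `P Q` by `(P Q)ᵀ (P Q) = Q P² Q`, which is cyclically `P² Q²`; the induction
    -- hypothesis then applies to the squares.
    have h1 := (le_abs_self _).trans (ih.1 (P * Q))
    obtain ⟨j, hj⟩ : ∃ j, 2 ^ k = j + 1 :=
      ⟨2 ^ k - 1, (Nat.sub_add_cancel Nat.one_le_two_pow).symm⟩
    have e : (((P * Q)ᵀ * (P * Q)) ^ 2 ^ k).trace = ((P * P * (Q * Q)) ^ 2 ^ k).trace := by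
      rw [transpose_mul, hP, hQ, hj]
      have : ∀ i : ℕ, (Q * P * (P * Q)) ^ (i + 1) = Q * (P * P * (Q * Q)) ^ i * (P * P * Q) := by
        intro i
        induction i with
        | zero => simp [mul_assoc]
        | succ i ih => rw [pow_succ, ih, pow_succ]; simp only [mul_assoc]
      rw [this, Matrix.trace_mul_comm, ← mul_assoc, Matrix.trace_mul_comm]
      rw [pow_succ]
      simp only [mul_assoc]
    have h2 := ih.2 (P * P) (Q * Q) (by rw [transpose_mul, hP]) (by rw [transpose_mul, hQ])
    rw [← pow_two P, ← pow_two Q, ← pow_mul, ← pow_mul, ← pow_succ'] at h2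
    rw [e, ← pow_two P, ← pow_two Q] at h1
    exact h1.trans h2

theorem norm_one_matrix_le : ‖(1 : Matrix n n ℝ)‖ ≤ 1 := by
  rw [← Matrix.diagonal_one, Matrix.l2_opNorm_diagonal]
  exact (pi_norm_le_iff_of_nonneg zero_le_one).mpr fun i => by simp

/-- The Golden–Thompson inequality. -/
theorem trace_exp_add_le (A B : Matrix n n ℝ) (hA : Aᵀ = A) (hB : Bᵀ = B) :
    (NormedSpace.exp (A + B)).trace ≤ (NormedSpace.exp A * NormedSpace.exp B).trace := by
  -- Powers of two suffice, as the product formula may be used along a subsequence.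
  have hlim := (tendsto_exp_mul_exp_pow norm_one_matrix_le A B).comp
    (tendsto_pow_atTop_atTop_of_one_lt (one_lt_two (α := ℕ)))
  have htr : Continuous fun M : Matrix n n ℝ => M.trace := continuous_id.matrix_trace
  refine le_of_tendsto ((htr.tendsto _).comp hlim) (Eventually.of_forall fun k => ?_)
  have hs : ∀ {C : Matrix n n ℝ}, Cᵀ = C → ∀ c : ℝ,
      (NormedSpace.exp (c • C))ᵀ = NormedSpace.exp (c • C) := fun h c => by
    rw [← Matrix.exp_transpose, transpose_smul, h]
  have hp : ∀ C : Matrix n n ℝ,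
      NormedSpace.exp (((2 ^ k : ℕ) : ℝ)⁻¹ • C) ^ 2 ^ k = NormedSpace.exp C := fun C => by
    rw [← Matrix.exp_nsmul, ← Nat.cast_smul_eq_nsmul ℝ, smul_smul,
      mul_inv_cancel₀ (by positivity), one_smul]
  have h := (trace_pow_two_pow_le k).2 _ _ (hs hA ((2 ^ k : ℕ) : ℝ)⁻¹) (hs hB ((2 ^ k : ℕ) : ℝ)⁻¹)
  rw [hp, hp] at h
  exact h

end GoldenThompson

/-! ### Exponentials and quadratic forms of symmetric matrices. -/

section SymmetricMatrix

open Matrix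

variable {n : Type*} [Fintype n] [DecidableEq n]

theorem exists_orthogonal_diagonalization {A : Matrix n n ℝ} (hA : Aᵀ = A) :
    ∃ (U : Matrix n n ℝ) (d : n → ℝ), U * Uᵀ = 1 ∧ Uᵀ * U = 1 ∧ A = U * diagonal d * Uᵀ := by
  have hA' : A.IsHermitian := by rwa [Matrix.IsHermitian, conjTranspose_eq_transpose_of_trivial]
  have hU := hA'.eigenvectorUnitary.2
  rw [Matrix.mem_unitaryGroup_iff] at hU
  have hU2 := hA'.eigenvectorUnitary.2
  rw [Matrix.mem_unitaryGroup_iff'] at hU2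
  rw [star_eq_conjTranspose, conjTranspose_eq_transpose_of_trivial] at hU hU2
  refine ⟨hA'.eigenvectorUnitary, hA'.eigenvalues, hU, hU2, ?_⟩
  have h := hA'.spectral_theorem
  rw [Unitary.conjStarAlgAut_apply, star_eq_conjTranspose,
    conjTranspose_eq_transpose_of_trivial] at h
  simpa using! h

theorem exp_orthogonal_conj {U : Matrix n n ℝ} (h : U * Uᵀ = 1) (d : n → ℝ) :
    NormedSpace.exp (U * diagonal d * Uᵀ) = U * diagonal (fun i => Real.exp (d i)) * Uᵀ := by
  have hinv : U⁻¹ = Uᵀ := Matrix.inv_eq_right_inv h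
  rw [← hinv, Matrix.exp_conj _ _ (IsUnit.of_mul_eq_one _ h), Matrix.exp_diagonal]
  congr 3
  ext i
  rw [Pi.coe_exp, Real.exp_eq_exp_ℝ]

theorem dotProduct_orthogonal_conj_mulVec (U : Matrix n n ℝ) (d x : n → ℝ) :
    x ⬝ᵥ (U * diagonal d * Uᵀ) *ᵥ x = ∑ i, d i * (Uᵀ *ᵥ x) i ^ 2 := by
  rw [← mulVec_mulVec, ← mulVec_mulVec, dotProduct_mulVec, ← mulVec_transpose]
  simp only [dotProduct, mulVec_diagonal]
  exact Finset.sum_congr rfl fun i _ => by ring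

theorem dotProduct_self_eq_sum_of_orthogonal {U : Matrix n n ℝ} (h : U * Uᵀ = 1) (x : n → ℝ) :
    x ⬝ᵥ x = ∑ i, (Uᵀ *ᵥ x) i ^ 2 := by
  have := dotProduct_orthogonal_conj_mulVec U (fun _ => 1) x
  simpa [h] using this

theorem exists_unit_vector_of_orthogonal {U : Matrix n n ℝ} (h : Uᵀ * U = 1) (d : n → ℝ) (i : n) :
    ∃ x : n → ℝ, x ⬝ᵥ x = 1 ∧ d i = x ⬝ᵥ (U * diagonal d * Uᵀ) *ᵥ x := by
  have hx : Uᵀ *ᵥ (U *ᵥ Pi.single i 1) = Pi.single i 1 := by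
    rw [mulVec_mulVec, h, one_mulVec]
  refine ⟨U *ᵥ Pi.single i 1, ?_, ?_⟩
  · rw [dotProduct_self_eq_sum_of_orthogonal (mul_eq_one_comm.mp h), hx]
    simp [Pi.single_apply]
  · rw [dotProduct_orthogonal_conj_mulVec, hx]
    simp [Pi.single_apply]

theorem real_exp_le_one_add_add_sq {x : ℝ} (hx : |x| ≤ 1) : Real.exp x ≤ 1 + x + x ^ 2 := by
  have h := Real.norm_exp_sub_one_sub_id_le (x := x) (by simpa using hx)
  have h2 := (le_abs_self _).trans h
  rw [Real.norm_eq_abs, sq_abs] at h2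
  linarith

/-- The quadratic form of `exp A` is at most that of `1 + A + A²` when `‖A‖ ≤ 1`. -/
theorem dotProduct_exp_mulVec_le {A : Matrix n n ℝ} (hA : Aᵀ = A)
    (h1 : ∀ x : n → ℝ, |x ⬝ᵥ A *ᵥ x| ≤ x ⬝ᵥ x) (x : n → ℝ) :
    x ⬝ᵥ NormedSpace.exp A *ᵥ x ≤ x ⬝ᵥ x + x ⬝ᵥ A *ᵥ x + (A *ᵥ x) ⬝ᵥ (A *ᵥ x) := by
  have hsq : (A *ᵥ x) ⬝ᵥ (A *ᵥ x) = x ⬝ᵥ (A * A) *ᵥ x := by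
    rw [← mulVec_mulVec, dotProduct_mulVec x, ← mulVec_transpose, hA]
  obtain ⟨U, d, hU, hU', rfl⟩ := exists_orthogonal_diagonalization hA
  have hAA : U * diagonal d * Uᵀ * (U * diagonal d * Uᵀ) = U * diagonal (fun i => d i ^ 2) * Uᵀ := by
    calc _ = U * diagonal d * (Uᵀ * U) * diagonal d * Uᵀ := by simp only [mul_assoc]
      _ = U * (diagonal d * diagonal d) * Uᵀ := by rw [hU']; simp only [mul_assoc, one_mul]
      _ = _ := by rw [diagonal_mul_diagonal]; simp only [pow_two]
  rw [hsq, hAA, exp_orthogonal_conj hU, dotProduct_orthogonal_conj_mulVec,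
    dotProduct_orthogonal_conj_mulVec, dotProduct_orthogonal_conj_mulVec,
    dotProduct_self_eq_sum_of_orthogonal hU, ← Finset.sum_add_distrib, ← Finset.sum_add_distrib]
  refine Finset.sum_le_sum fun i _ => ?_
  have hd : |d i| ≤ 1 := by
    obtain ⟨y, hy, hdy⟩ := exists_unit_vector_of_orthogonal hU' d i
    rw [hdy, ← hy]
    exact h1 y
  nlinarith [real_exp_le_one_add_add_sq hd, sq_nonneg ((Uᵀ *ᵥ x) i)]

theorem exp_eq_transpose_mul_self {A : Matrix n n ℝ} (hA : Aᵀ = A) :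
    ∃ C : Matrix n n ℝ, NormedSpace.exp A = Cᵀ * C := by
  refine ⟨NormedSpace.exp ((2 : ℝ)⁻¹ • A), ?_⟩
  rw [← Matrix.exp_transpose, transpose_smul, hA, ← pow_two, ← Matrix.exp_nsmul,
    ← Nat.cast_smul_eq_nsmul ℝ, smul_smul]
  simp

theorem trace_exp_nonneg {A : Matrix n n ℝ} (hA : Aᵀ = A) : 0 ≤ (NormedSpace.exp A).trace := by
  obtain ⟨C, hC⟩ := exp_eq_transpose_mul_self hA
  rw [hC]
  exact trace_transpose_mul_self_nonneg C

/-- With `exp A = Cᵀ C`, the trace is the sum of the quadratic form of `G` over the rows of `C`. -/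
theorem trace_exp_mul_le {A G : Matrix n n ℝ} (hA : Aᵀ = A) {β : ℝ}
    (hG : ∀ x : n → ℝ, x ⬝ᵥ G *ᵥ x ≤ β * (x ⬝ᵥ x)) :
    (NormedSpace.exp A * G).trace ≤ β * (NormedSpace.exp A).trace := by
  obtain ⟨C, hC⟩ := exp_eq_transpose_mul_self hA
  have e : ∀ H : Matrix n n ℝ, (Cᵀ * C * H).trace = ∑ i, C i ⬝ᵥ H *ᵥ C i := fun H => by
    rw [mul_assoc, trace_mul_comm, mul_assoc]
    simp only [Matrix.trace, Matrix.diag_apply, Matrix.mul_apply, dotProduct, mulVec,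
      transpose_apply]
  have e1 := e 1
  rw [mul_one] at e1
  rw [hC, e, e1, Finset.mul_sum]
  simpa using Finset.sum_le_sum fun i _ => hG (C i)

/-- Some eigenvalue of `A` or of `-A` exceeds `u`, and all other eigenvalues contribute positive
terms to the traces. -/
theorem exp_le_trace_exp_add_trace_exp_neg {A : Matrix n n ℝ} (hA : Aᵀ = A) {u : ℝ} (hu0 : 0 ≤ u)
    (hu : u < ‖A‖) :
    Real.exp u ≤ (NormedSpace.exp A).trace + (NormedSpace.exp (-A)).trace := by
  obtain ⟨U, d, hU, hU', rfl⟩ := exists_orthogonal_diagonalization hA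
  have hneg : -(U * diagonal d * Uᵀ) = U * diagonal (-d) * Uᵀ := by
    rw [show diagonal (-d) = -diagonal d from (diagonal_neg d).symm, mul_neg, neg_mul]
  have htr : ∀ e : n → ℝ, (U * diagonal e * Uᵀ).trace = ∑ i, e i := fun e => by
    rw [trace_mul_comm, ← mul_assoc, hU', one_mul, trace_diagonal]
  rw [hneg, exp_orthogonal_conj hU, exp_orthogonal_conj hU, htr, htr]
  have hnU : ‖U‖ ≤ 1 := by
    have h := Matrix.l2_opNorm_conjTranspose_mul_self U
    rw [conjTranspose_eq_transpose_of_trivial, hU'] at h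
    nlinarith [norm_one_matrix_le (n := n), norm_nonneg U]
  have hnU' : ‖Uᵀ‖ ≤ 1 := by
    rw [← conjTranspose_eq_transpose_of_trivial, Matrix.l2_opNorm_conjTranspose]
    exact hnU
  have hle : ‖U * diagonal d * Uᵀ‖ ≤ ‖d‖ := by
    calc _ ≤ ‖U‖ * ‖diagonal d‖ * ‖Uᵀ‖ :=
          (norm_mul_le _ _).trans (mul_le_mul_of_nonneg_right (norm_mul_le _ _) (norm_nonneg _))
      _ ≤ 1 * ‖diagonal d‖ * 1 := by gcongr
      _ = ‖d‖ := by rw [Matrix.l2_opNorm_diagonal]; ring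
  obtain ⟨i, hi⟩ : ∃ i, u < |d i| := by
    by_contra! h
    exact absurd ((pi_norm_le_iff_of_nonneg hu0).mpr fun i => by simpa using h i)
      (not_le.mpr (hu.trans_le hle))
  rw [← Finset.sum_add_distrib]
  refine le_trans ?_ (Finset.single_le_sum (f := fun i => Real.exp (d i) + Real.exp ((-d) i))
    (fun j _ => by positivity) (Finset.mem_univ i))
  have h1 := Real.exp_pos (d i)
  have h2 := Real.exp_pos (-d i)
  rcases lt_abs.mp hi with h | h
  · have := Real.exp_le_exp.mpr h.le
    simp only [Pi.neg_apply]; linarith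
  · have := Real.exp_le_exp.mpr h.le
    simp only [Pi.neg_apply]; linarith

theorem abs_apply_le_l2_opNorm (A : Matrix n n ℝ) (i j : n) : |A i j| ≤ ‖A‖ := by
  have h := Matrix.l2_opNorm_mulVec A (EuclideanSpace.single j 1)
  have h2 := PiLp.norm_apply_le (WithLp.toLp 2 (A *ᵥ (EuclideanSpace.single j (1 : ℝ)).ofLp)) i
  rw [PiLp.norm_single, norm_one, mul_one] at h
  simpa using h2.trans h

end SymmetricMatrix

/-! ### Matrix Bernstein inequality by the Ahlswede–Winter method. -/

section MatrixConcentration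

open Matrix

variable {n : Type*} [Fintype n] [DecidableEq n]
variable {Ξ Ω : Type*} [MeasurableSpace Ξ] [MeasurableSpace Ω]

theorem integrable_of_measurable_of_abs_le {μ : Measure Ω} [IsFiniteMeasure μ] {f : Ω → ℝ}
    (hf : AEMeasurable f μ) {C : ℝ} (hC : ∀ ω, |f ω| ≤ C) : Integrable f μ :=
  Integrable.of_bound hf.aestronglyMeasurable C (Filter.Eventually.of_forall hC)

theorem measurable_matrix_exp_apply {Z : Ξ → Matrix n n ℝ}
    (hZ : ∀ a b, Measurable fun ξ => Z ξ a b) (a b : n) :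
    Measurable fun ξ => NormedSpace.exp (Z ξ) a b := by
  let := NormedAlgebra.ratOfReal (Matrix n n ℝ)
  have hc : Continuous fun A : n → n → ℝ => NormedSpace.exp (Matrix.of A) a b :=
    (continuous_apply_apply a b).comp (NormedSpace.exp_continuous (𝔸 := Matrix n n ℝ))
  exact hc.measurable.comp (measurable_pi_lambda _ fun a => measurable_pi_lambda _ fun b => hZ a b)

theorem abs_exp_apply_le {A : Matrix n n ℝ} {C : ℝ} (hA : ‖A‖ ≤ C) (a b : n) :
    |NormedSpace.exp A a b| ≤ Real.exp C :=
  (abs_apply_le_l2_opNorm _ a b).trans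
    ((norm_exp_le_exp_norm norm_one_matrix_le A).trans (Real.exp_le_exp.mpr hA))

theorem integrable_exp_apply {μ : Measure Ω} [IsFiniteMeasure μ] {Z : Ω → Matrix n n ℝ}
    (hZ : ∀ a b, AEMeasurable (fun ω => NormedSpace.exp (Z ω) a b) μ) {C : ℝ} (hC : ∀ ω, ‖Z ω‖ ≤ C)
    (a b : n) : Integrable (fun ω => NormedSpace.exp (Z ω) a b) μ :=
  integrable_of_measurable_of_abs_le (hZ a b) fun ω => abs_exp_apply_le (hC ω) a b

theorem integrable_dotProduct_mulVec {μ : Measure Ω} {G : Ω → Matrix n n ℝ}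
    (hG : ∀ a b, Integrable (fun ω => G ω a b) μ) (y x : n → ℝ) :
    Integrable (fun ω => y ⬝ᵥ G ω *ᵥ x) μ := by
  simp only [dotProduct, mulVec]
  exact integrable_finsetSum _ fun i _ => (integrable_finsetSum _ fun j _ =>
    (hG i j).mul_const _).const_mul _

theorem integral_dotProduct_mulVec {μ : Measure Ω} {G : Ω → Matrix n n ℝ}
    (hG : ∀ a b, Integrable (fun ω => G ω a b) μ) (y x : n → ℝ) :
    ∫ ω, y ⬝ᵥ G ω *ᵥ x ∂μ = y ⬝ᵥ (Matrix.of fun a b => ∫ ω, G ω a b ∂μ) *ᵥ x := by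
  simp only [dotProduct, mulVec, Matrix.of_apply]
  rw [integral_finsetSum _ fun i _ => (integrable_finsetSum _ fun j _ =>
    (hG i j).mul_const _).const_mul _]
  refine Finset.sum_congr rfl fun i _ => ?_
  rw [integral_const_mul, integral_finsetSum _ fun j _ => (hG i j).mul_const _]
  simp only [integral_mul_const]

variable {P : Measure Ω} [IsProbabilityMeasure P] {ν : Measure Ξ}

/-- The trace of the matrix moment generating function of a sum of independent identically
distributed random symmetric matrices. -/
theorem integral_trace_exp_sum_le {N : ℕ} {X : Fin N → Ω → Ξ} (hX : iIndepFun X P)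
    (hlaw : ∀ i, HasLaw (X i) ν P) {Z : Ξ → Matrix n n ℝ}
    (hZ : ∀ a b, Measurable fun ξ => Z ξ a b) (hsymm : ∀ ξ, (Z ξ)ᵀ = Z ξ)
    {C : ℝ} (hC : ∀ ξ, ‖Z ξ‖ ≤ C) {β : ℝ} (hβ0 : 0 ≤ β)
    (hβ : ∀ x : n → ℝ, ∫ ξ, x ⬝ᵥ NormedSpace.exp (Z ξ) *ᵥ x ∂ν ≤ β * (x ⬝ᵥ x))
    (s : Finset (Fin N)) :
    ∫ ω, (NormedSpace.exp (∑ i ∈ s, Z (X i ω))).trace ∂P ≤ Fintype.card n * β ^ s.card := by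
  have hXm : ∀ i, AEMeasurable (X i) P := fun i => (hlaw i).aemeasurable
  induction s using Finset.induction_on with
  | empty => simp
  | insert i s his ih =>
    have hsymm_sum : ∀ ω, (∑ j ∈ s, Z (X j ω))ᵀ = ∑ j ∈ s, Z (X j ω) := fun ω => by
      rw [transpose_sum]; simp only [hsymm]
    have hsum_norm : ∀ ω, ‖∑ j ∈ s, Z (X j ω)‖ ≤ s.card * C := fun ω =>
      (norm_sum_le _ _).trans ((Finset.sum_le_sum fun j _ => hC _).trans_eq (by simp))
    set F : Ω → Matrix n n ℝ := fun ω => NormedSpace.exp (∑ j ∈ s, Z (X j ω)) with hF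
    set G : Ω → Matrix n n ℝ := fun ω => NormedSpace.exp (Z (X i ω)) with hG
    -- `F` is written as a function of the subfamily indexed by `s`, so that independence of the
    -- disjoint index sets `s` and `{i}` applies.
    have hFs : ∀ a b, Measurable fun y : s → Ξ => NormedSpace.exp (∑ j : s, Z (y j)) a b :=
      measurable_matrix_exp_apply fun a b => by
        simp only [Matrix.sum_apply]
        exact Finset.measurable_sum _ fun j _ => (hZ a b).comp (measurable_pi_apply j)
    have hFeq : ∀ ω a b, F ω a b =
        (fun y : s → Ξ => NormedSpace.exp (∑ j : s, Z (y j)) a b) fun j : s => X j ω := by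
      intro ω a b
      simp only [hF]
      rw [← Finset.sum_coe_sort s]
    have hGm : ∀ a b, Measurable fun ξ => NormedSpace.exp (Z ξ) a b := measurable_matrix_exp_apply hZ
    have hFae : ∀ a b, AEMeasurable (fun ω => F ω a b) P := fun a b => by
      simp only [hFeq]
      exact (hFs a b).comp_aemeasurable (aemeasurable_pi_lambda _ fun j => hXm j)
    have hGae : ∀ a b, AEMeasurable (fun ω => G ω a b) P := fun a b =>
      (hGm a b).comp_aemeasurable (hXm i)
    have hFint := integrable_exp_apply hFae hsum_norm
    have hGint := integrable_exp_apply hGae fun ω => hC (X i ω)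
    have hindep : ∀ a b c d, IndepFun (fun ω => F ω a b) (fun ω => G ω c d) P := by
      intro a b c d
      have h := (hX.indepFun_finset₀ s {i} (by simpa using his) hXm).comp (hFs a b)
        ((hGm c d).comp (measurable_pi_apply (⟨i, Finset.mem_singleton_self i⟩ : ({i} : Finset _))))
      convert h using 1
      · ext ω
        exact hFeq ω a b
      · rfl
    have hFGint : ∀ a b, Integrable (fun ω => F ω a b * G ω b a) P := fun a b =>
      (hindep a b b a).integrable_mul (hFint a b) (hGint b a)
    have htr : ∀ A B : Matrix n n ℝ, (A * B).trace = ∑ a, ∑ b, A a b * B b a := fun A B => by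
      simp only [Matrix.trace, Matrix.diag_apply, Matrix.mul_apply]
    set EG : Matrix n n ℝ := Matrix.of fun a b => ∫ ω, G ω a b ∂P with hEG
    have hEGβ : ∀ x : n → ℝ, x ⬝ᵥ EG *ᵥ x ≤ β * (x ⬝ᵥ x) := fun x => by
      rw [hEG, ← integral_dotProduct_mulVec hGint]
      refine le_trans (le_of_eq ?_) (hβ x)
      refine (hlaw i).integral_comp (f := fun ξ => x ⬝ᵥ NormedSpace.exp (Z ξ) *ᵥ x) ?_
      refine Measurable.aestronglyMeasurable ?_
      simp only [dotProduct, mulVec]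
      exact Finset.measurable_sum _ fun a _ => (Finset.measurable_sum _ fun b _ =>
        (hGm a b).mul_const _).const_mul _
    have hFtr : Integrable (fun ω => (F ω).trace) P :=
      integrable_finsetSum _ fun a _ => hFint a a
    have hFEG : Integrable (fun ω => (F ω * EG).trace) P := by
      simp only [htr]
      exact integrable_finsetSum _ fun a _ => integrable_finsetSum _ fun b _ =>
        (hFint a b).mul_const _
    have hprod : ∫ ω, (F ω * G ω).trace ∂P = ∫ ω, (F ω * EG).trace ∂P := by
      simp only [htr]
      rw [integral_finsetSum _ fun a _ => integrable_finsetSum _ fun b _ => hFGint a b,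
        integral_finsetSum _ fun a _ => integrable_finsetSum _ fun b _ => (hFint a b).mul_const _]
      refine Finset.sum_congr rfl fun a _ => ?_
      rw [integral_finsetSum _ fun b _ => hFGint a b,
        integral_finsetSum _ fun b _ => (hFint a b).mul_const _]
      refine Finset.sum_congr rfl fun b _ => ?_
      rw [integral_mul_const, (hindep a b b a).integral_fun_mul_eq_mul_integral
        (hFae a b).aestronglyMeasurable (hGae b a).aestronglyMeasurable]
      rfl
    -- Golden–Thompson detaches the new summand. By `hprod` it may then be replaced by its mean
    -- `EG`, whose quadratic form is at most `β`.
    have hGT : ∫ ω, (NormedSpace.exp (∑ j ∈ insert i s, Z (X j ω))).trace ∂P ≤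
        ∫ ω, (F ω * G ω).trace ∂P := by
      refine integral_mono_of_nonneg (Filter.Eventually.of_forall fun ω => ?_) ?_
        (Filter.Eventually.of_forall fun ω => ?_)
      · refine trace_exp_nonneg ?_
        rw [transpose_sum]; simp only [hsymm]
      · simp only [htr]
        exact integrable_finsetSum _ fun a _ => integrable_finsetSum _ fun b _ => hFGint a b
      · simp only [Finset.sum_insert his]
        rw [add_comm]
        exact trace_exp_add_le _ _ (hsymm_sum ω) (hsymm _)
    calc _ ≤ ∫ ω, (F ω * G ω).trace ∂P := hGT
      _ = ∫ ω, (F ω * EG).trace ∂P := hprod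
      _ ≤ ∫ ω, β * (F ω).trace ∂P :=
        integral_mono hFEG (hFtr.const_mul _) fun ω => trace_exp_mul_le (hsymm_sum ω) hEGβ
      _ = β * ∫ ω, (F ω).trace ∂P := integral_const_mul _ _
      _ ≤ β * (Fintype.card n * β ^ s.card) := by gcongr
      _ = _ := by rw [Finset.card_insert_of_notMem his, pow_succ]; ring

theorem mulVec_dotProduct_mulVec_eq {A : Matrix n n ℝ} (hA : Aᵀ = A) (x : n → ℝ) :
    (A *ᵥ x) ⬝ᵥ (A *ᵥ x) = x ⬝ᵥ (A * A) *ᵥ x := by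
  rw [← mulVec_mulVec, dotProduct_mulVec x, ← mulVec_transpose, hA]

/-- A bound on the matrix moment generating function of a centered random symmetric matrix. -/
theorem integral_dotProduct_exp_mulVec_le [IsProbabilityMeasure ν] {Z : Ξ → Matrix n n ℝ}
    (hZ : ∀ a b, Measurable fun ξ => Z ξ a b) (hsymm : ∀ ξ, (Z ξ)ᵀ = Z ξ)
    {C : ℝ} (hC : ∀ ξ, ‖Z ξ‖ ≤ C) (hmean : ∀ a b, ∫ ξ, Z ξ a b ∂ν = 0)
    (hR : ∀ᵐ ξ ∂ν, ∀ x : n → ℝ, |x ⬝ᵥ Z ξ *ᵥ x| ≤ x ⬝ᵥ x) {V : ℝ}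
    (hV : ∀ x : n → ℝ, ∫ ξ, (Z ξ *ᵥ x) ⬝ᵥ (Z ξ *ᵥ x) ∂ν ≤ V * (x ⬝ᵥ x)) (x : n → ℝ) :
    ∫ ξ, x ⬝ᵥ NormedSpace.exp (Z ξ) *ᵥ x ∂ν ≤ (1 + V) * (x ⬝ᵥ x) := by
  have hZint : ∀ a b, Integrable (fun ξ => Z ξ a b) ν := fun a b =>
    integrable_of_measurable_of_abs_le (hZ a b).aemeasurable fun ξ =>
      (abs_apply_le_l2_opNorm _ a b).trans (hC ξ)
  have hZZint : ∀ a b, Integrable (fun ξ => (Z ξ * Z ξ) a b) ν := fun a b => by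
    refine integrable_of_measurable_of_abs_le (C := C * C) (Measurable.aemeasurable ?_) fun ξ =>
      (abs_apply_le_l2_opNorm _ a b).trans ((norm_mul_le _ _).trans
        (mul_self_le_mul_self (norm_nonneg _) (hC ξ)))
    simp only [Matrix.mul_apply]
    exact Finset.measurable_sum _ fun c _ => (hZ a c).mul (hZ c b)
  have hexp := integrable_exp_apply (fun a b =>
    (measurable_matrix_exp_apply hZ a b).aemeasurable (μ := ν)) hC
  have h1 := integrable_dotProduct_mulVec hZint x x
  have h2 : Integrable (fun ξ => (Z ξ *ᵥ x) ⬝ᵥ (Z ξ *ᵥ x)) ν := by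
    simp only [mulVec_dotProduct_mulVec_eq (hsymm _)]
    exact integrable_dotProduct_mulVec hZZint x x
  have h01 : Integrable (fun ξ => x ⬝ᵥ x + x ⬝ᵥ Z ξ *ᵥ x) ν := (integrable_const _).add h1
  have hm : ∫ ξ, x ⬝ᵥ Z ξ *ᵥ x ∂ν = 0 := by
    rw [integral_dotProduct_mulVec hZint]
    simp only [hmean]
    have : (Matrix.of fun _ _ : n => (0 : ℝ)) = 0 := rfl
    rw [this]; simp
  calc ∫ ξ, x ⬝ᵥ NormedSpace.exp (Z ξ) *ᵥ x ∂ν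
      ≤ ∫ ξ, (x ⬝ᵥ x + x ⬝ᵥ Z ξ *ᵥ x + (Z ξ *ᵥ x) ⬝ᵥ (Z ξ *ᵥ x)) ∂ν := by
        refine integral_mono_ae (integrable_dotProduct_mulVec hexp x x)
          (h01.add h2) ?_
        filter_upwards [hR] with ξ hξ
        exact dotProduct_exp_mulVec_le (hsymm ξ) hξ x
    _ = x ⬝ᵥ x + 0 + ∫ ξ, (Z ξ *ᵥ x) ⬝ᵥ (Z ξ *ᵥ x) ∂ν := by
        rw [integral_add h01 h2, integral_add (integrable_const _) h1, hm]
        simp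
    _ ≤ (1 + V) * (x ⬝ᵥ x) := by linarith [hV x]

/-- A Bernstein inequality for sums of independent identically distributed centered random
symmetric matrices. -/
theorem measureReal_lt_norm_sum_le [IsProbabilityMeasure ν] {N : ℕ} {X : Fin N → Ω → Ξ}
    (hX : iIndepFun X P) (hlaw : ∀ i, HasLaw (X i) ν P) {Z : Ξ → Matrix n n ℝ}
    (hZ : ∀ a b, Measurable fun ξ => Z ξ a b) (hsymm : ∀ ξ, (Z ξ)ᵀ = Z ξ)
    {C : ℝ} (hC : ∀ ξ, ‖Z ξ‖ ≤ C) (hmean : ∀ a b, ∫ ξ, Z ξ a b ∂ν = 0) {R V θ u : ℝ}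
    (hR : ∀ᵐ ξ ∂ν, ∀ x : n → ℝ, |x ⬝ᵥ Z ξ *ᵥ x| ≤ R * (x ⬝ᵥ x))
    (hV0 : 0 ≤ V) (hV : ∀ x : n → ℝ, ∫ ξ, (Z ξ *ᵥ x) ⬝ᵥ (Z ξ *ᵥ x) ∂ν ≤ V * (x ⬝ᵥ x))
    (hθ : 0 < θ) (hθR : θ * R ≤ 1) (hu : 0 ≤ u) :
    P.real {ω | u < ‖∑ i, Z (X i ω)‖} ≤
      2 * Fintype.card n * Real.exp (-(θ * u) + N * (θ ^ 2 * V)) := by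
  have hsum_symm : ∀ ω, (∑ i, Z (X i ω))ᵀ = ∑ i, Z (X i ω) := fun ω => by
    rw [transpose_sum]; simp only [hsymm]
  -- Both signs are needed, since the norm sees the largest and the smallest eigenvalue; this
  -- produces the factor 2.
  have mgf : ∀ c : ℝ, |c| = θ →
      (∫ ω, (NormedSpace.exp (c • ∑ i, Z (X i ω))).trace ∂P ≤
        Fintype.card n * Real.exp (N * (θ ^ 2 * V))) ∧
      Integrable (fun ω => (NormedSpace.exp (c • ∑ i, Z (X i ω))).trace) P := by
    intro c hc
    have hZ' : ∀ a b, Measurable fun ξ => (c • Z ξ) a b := fun a b => (hZ a b).const_mul c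
    have hsymm' : ∀ ξ, (c • Z ξ)ᵀ = c • Z ξ := fun ξ => by rw [transpose_smul, hsymm]
    have hC' : ∀ ξ, ‖c • Z ξ‖ ≤ θ * C := fun ξ => by
      rw [norm_smul, Real.norm_eq_abs, hc]
      exact mul_le_mul_of_nonneg_left (hC ξ) hθ.le
    have hc2 : c * c = θ ^ 2 := by rw [← hc, sq_abs, pow_two]
    have hone := integral_dotProduct_exp_mulVec_le (ν := ν) hZ' hsymm' hC'
      (fun a b => by
        simp only [Matrix.smul_apply, smul_eq_mul]
        rw [integral_const_mul, hmean, mul_zero])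
      (by
        filter_upwards [hR] with ξ hξ x
        have hxx : 0 ≤ x ⬝ᵥ x := Finset.sum_nonneg fun i _ => mul_self_nonneg (x i)
        rw [smul_mulVec, dotProduct_smul, smul_eq_mul, abs_mul, hc]
        calc θ * |x ⬝ᵥ Z ξ *ᵥ x| ≤ θ * (R * (x ⬝ᵥ x)) := by gcongr; exact hξ x
          _ = θ * R * (x ⬝ᵥ x) := by ring
          _ ≤ 1 * (x ⬝ᵥ x) := by gcongr
          _ = x ⬝ᵥ x := one_mul _)
      (V := θ ^ 2 * V)
      (fun x => by
        simp only [smul_mulVec, dotProduct_smul, smul_dotProduct, smul_eq_mul, ← mul_assoc, hc2]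
        rw [integral_const_mul, mul_assoc]
        exact mul_le_mul_of_nonneg_left (hV x) (sq_nonneg θ))
    have hmain := integral_trace_exp_sum_le hX hlaw hZ' hsymm' hC' (by positivity) hone Finset.univ
    simp only [← Finset.smul_sum] at hmain
    refine ⟨hmain.trans ?_, ?_⟩
    · rw [Finset.card_univ, Fintype.card_fin, Real.exp_nat_mul]
      gcongr
      rw [add_comm]
      exact Real.add_one_le_exp _
    · refine integrable_finsetSum _ fun a _ => integrable_exp_apply (C := θ * (N * C))
        (fun a b => ?_) (fun ω => ?_) a a
      · have hm := measurable_matrix_exp_apply (Ξ := Fin N → Ξ) (Z := fun y => c • ∑ i, Z (y i))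
          (fun a b => by
            simp only [Matrix.smul_apply, Matrix.sum_apply]
            exact (Finset.measurable_sum _ fun j _ =>
              (hZ a b).comp (measurable_pi_apply j)).const_mul c) a b
        exact hm.comp_aemeasurable (aemeasurable_pi_lambda _ fun j => (hlaw j).aemeasurable)
      · rw [norm_smul, Real.norm_eq_abs, hc]
        refine mul_le_mul_of_nonneg_left ?_ hθ.le
        exact (norm_sum_le _ _).trans ((Finset.sum_le_sum fun j _ => hC _).trans_eq (by simp))
  obtain ⟨hp, hpi⟩ := mgf θ (abs_of_pos hθ)
  obtain ⟨hm, hmi⟩ := mgf (-θ) (by rw [abs_neg, abs_of_pos hθ])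
  set f : Ω → ℝ := fun ω => (NormedSpace.exp (θ • ∑ i, Z (X i ω))).trace +
    (NormedSpace.exp (-θ • ∑ i, Z (X i ω))).trace with hf
  have hf0 : ∀ ω, 0 ≤ f ω := fun ω => add_nonneg
    (trace_exp_nonneg (by rw [transpose_smul, hsum_symm]))
    (trace_exp_nonneg (by rw [transpose_smul, hsum_symm]))
  have hsub : {ω | u < ‖∑ i, Z (X i ω)‖} ⊆ {ω | Real.exp (θ * u) ≤ f ω} := by
    intro ω hω
    have h := exp_le_trace_exp_add_trace_exp_neg (A := θ • ∑ i, Z (X i ω))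
      (by rw [transpose_smul, hsum_symm]) (u := θ * u) (by positivity)
      (by rw [norm_smul, Real.norm_of_nonneg hθ.le]; exact mul_lt_mul_of_pos_left hω hθ)
    rw [← neg_smul] at h
    exact h
  have hmarkov := mul_meas_ge_le_integral_of_nonneg (μ := P)
    (Filter.Eventually.of_forall hf0) (hpi.add hmi) (Real.exp (θ * u))
  have hint : ∫ ω, f ω ∂P ≤ 2 * Fintype.card n * Real.exp (N * (θ ^ 2 * V)) := by
    rw [hf, integral_add hpi hmi]; linarith
  rw [Real.exp_add, Real.exp_neg]
  calc P.real {ω | u < ‖∑ i, Z (X i ω)‖} ≤ P.real {ω | Real.exp (θ * u) ≤ f ω} :=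
        measureReal_mono hsub
    _ ≤ (Real.exp (θ * u))⁻¹ * ∫ ω, f ω ∂P := by
        rw [le_inv_mul_iff₀ (Real.exp_pos _)]; exact hmarkov
    _ ≤ (Real.exp (θ * u))⁻¹ * (2 * Fintype.card n * Real.exp (N * (θ ^ 2 * V))) := by gcongr
    _ = _ := by ring

end MatrixConcentration

/-! ### Concentration of sums of rank-one matrices. -/

section GramMatrix

open Matrix

variable {n : Type*} [Fintype n] [DecidableEq n]
variable {Ξ Ω : Type*} [MeasurableSpace Ξ] [MeasurableSpace Ω]

/-- A crude bound that serves integrability only and does not enter the rate. -/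
theorem l2_opNorm_le_of_abs_apply_le {A : Matrix n n ℝ} {K : ℝ} (hA : ∀ a b, |A a b| ≤ K) :
    ‖A‖ ≤ ∑ a, ∑ b, K * ‖(Matrix.single a b 1 : Matrix n n ℝ)‖ := by
  conv_lhs => rw [Matrix.matrix_eq_sum_single A]
  refine (norm_sum_le _ _).trans (Finset.sum_le_sum fun a _ =>
    (norm_sum_le _ _).trans (Finset.sum_le_sum fun b _ => ?_))
  rw [show Matrix.single a b (A a b) = A a b • (Matrix.single a b 1 : Matrix n n ℝ) by simp, norm_smul]
  exact mul_le_mul_of_nonneg_right (hA a b) (norm_nonneg _)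

theorem dotProduct_vecMulVec_mulVec (v y x : n → ℝ) :
    y ⬝ᵥ vecMulVec v v *ᵥ x = (v ⬝ᵥ y) * (v ⬝ᵥ x) := by
  rw [vecMulVec_mulVec, dotProduct_smul, dotProduct_comm y v]
  simp

theorem sq_dotProduct_le (v x : n → ℝ) : (v ⬝ᵥ x) ^ 2 ≤ (v ⬝ᵥ v) * (x ⬝ᵥ x) := by
  simpa [dotProduct, pow_two] using Finset.sum_mul_sq_le_sq_mul_sq Finset.univ v x

variable {P : Measure Ω} [IsProbabilityMeasure P] {ν : Measure Ξ}

/-- Concentration of the Gram matrix of independent identically distributed bounded random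
vectors around its expectation. -/
theorem measureReal_lt_norm_sum_vecMulVec_sub_le [IsProbabilityMeasure ν] {N : ℕ} (hN : 0 < N)
    {X : Fin N → Ω → Ξ} (hX : iIndepFun X P) (hlaw : ∀ i, HasLaw (X i) ν P) {v : Ξ → n → ℝ}
    (hv : ∀ j, Measurable fun ξ => v ξ j) {C : ℝ} (hC : ∀ ξ j, |v ξ j| ≤ C) {R : ℝ} (hR0 : 0 < R)
    (hR : ∀ᵐ ξ ∂ν, v ξ ⬝ᵥ v ξ ≤ R) {M : Matrix n n ℝ} (hM : ∀ j k, M j k = ∫ ξ, v ξ j * v ξ k ∂ν)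
    (hM1 : ∀ x : n → ℝ, N * (x ⬝ᵥ M *ᵥ x) ≤ x ⬝ᵥ x)
    {a u : ℝ} (ha : 0 < a) (ha1 : a ≤ 1) (hau : 2 * a ≤ u) :
    P.real {ω | u < ‖∑ i, vecMulVec (v (X i ω)) (v (X i ω)) - N • M‖} ≤
      2 * Fintype.card n * Real.exp (-(a * u / 2 * R⁻¹)) := by
  have hN' : (0 : ℝ) < N := by exact_mod_cast hN
  have hvvm : ∀ a b, Measurable fun ξ => vecMulVec (v ξ) (v ξ) a b := fun a b =>
    (hv a).mul (hv b)
  have hvvC : ∀ ξ a b, |vecMulVec (v ξ) (v ξ) a b| ≤ C * C := fun ξ a b => by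
    rw [vecMulVec_apply, abs_mul]
    exact mul_le_mul (hC ξ a) (hC ξ b) (abs_nonneg _) ((abs_nonneg _).trans (hC ξ a))
  have hvvi : ∀ a b, Integrable (fun ξ => vecMulVec (v ξ) (v ξ) a b) ν := fun a b =>
    integrable_of_measurable_of_abs_le (hvvm a b).aemeasurable fun ξ => hvvC ξ a b
  have hMeq : M = Matrix.of fun a b => ∫ ξ, vecMulVec (v ξ) (v ξ) a b ∂ν := by
    ext a b; exact hM a b
  have hbil : ∀ y x : n → ℝ, ∫ ξ, (v ξ ⬝ᵥ y) * (v ξ ⬝ᵥ x) ∂ν = y ⬝ᵥ M *ᵥ x := fun y x => by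
    rw [hMeq, ← integral_dotProduct_mulVec hvvi]
    simp only [dotProduct_vecMulVec_mulVec]
  have hbili : ∀ y x : n → ℝ, Integrable (fun ξ => (v ξ ⬝ᵥ y) * (v ξ ⬝ᵥ x)) ν := fun y x => by
    have h := integrable_dotProduct_mulVec hvvi y x
    simpa only [dotProduct_vecMulVec_mulVec] using h
  have hMs : Mᵀ = M := by
    ext a b
    rw [transpose_apply, hM, hM]
    simp only [mul_comm]
  have hxx : ∀ x : n → ℝ, 0 ≤ x ⬝ᵥ x := fun x => Finset.sum_nonneg fun i _ => mul_self_nonneg (x i)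
  have hMnn : ∀ x : n → ℝ, 0 ≤ x ⬝ᵥ M *ᵥ x := fun x => by
    rw [← hbil]; exact integral_nonneg fun ξ => mul_self_nonneg _
  have hvx : ∀ x : n → ℝ, ∀ ξ, v ξ ⬝ᵥ v ξ ≤ R → (v ξ ⬝ᵥ x) * (v ξ ⬝ᵥ x) ≤ R * (x ⬝ᵥ x) :=
    fun x ξ hξ => by
      rw [← pow_two]
      exact (sq_dotProduct_le _ _).trans (mul_le_mul_of_nonneg_right hξ (hxx x))
  have hMR : ∀ x : n → ℝ, x ⬝ᵥ M *ᵥ x ≤ R * (x ⬝ᵥ x) := fun x => by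
    rw [← hbil]
    calc _ ≤ ∫ _, R * (x ⬝ᵥ x) ∂ν := by
          refine integral_mono_ae (hbili x x) (integrable_const _) ?_
          filter_upwards [hR] with ξ hξ using hvx x ξ hξ
      _ = _ := by simp
  set Z : Ξ → Matrix n n ℝ := fun ξ => vecMulVec (v ξ) (v ξ) - M with hZ
  have hZsymm : ∀ ξ, (Z ξ)ᵀ = Z ξ := fun ξ => by
    simp only [hZ]
    rw [transpose_sub, hMs, transpose_vecMulVec]
  -- With these values `θ R = a ≤ 1`, and the exponent is `-(a u - a²) / R`, where `a² ≤ a u / 2`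
  -- because `2 a ≤ u`.
  have hbound := measureReal_lt_norm_sum_le (Z := Z) (R := R) (V := R / N) (θ := a / R) (u := u)
    (C := ∑ a, ∑ b, C * C * ‖(Matrix.single a b 1 : Matrix n n ℝ)‖ + ‖M‖) hX hlaw
    (fun a b => (hvvm a b).sub_const _) hZsymm
    (fun ξ => (norm_sub_le _ _).trans (add_le_add_left (l2_opNorm_le_of_abs_apply_le (hvvC ξ)) _))
    (fun a b => by
      simp only [hZ, Matrix.sub_apply]
      rw [integral_sub (hvvi a b) (integrable_const _), hM]
      simp [vecMulVec_apply])
    (by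
      filter_upwards [hR] with ξ hξ x
      simp only [hZ]
      rw [sub_mulVec, dotProduct_sub, dotProduct_vecMulVec_mulVec, abs_le]
      constructor <;> nlinarith [hvx x ξ hξ, hMR x, hMnn x, mul_self_nonneg (v ξ ⬝ᵥ x), hxx x])
    (by positivity)
    (fun x => by
      -- The variance is `E (|v|² v vᵀ) - M² ≤ R • M`, and `N • M ≤ 1` brings this down to `R / N`.
      have hexpand : ∀ ξ, (Z ξ *ᵥ x) ⬝ᵥ (Z ξ *ᵥ x) = (v ξ ⬝ᵥ v ξ) * ((v ξ ⬝ᵥ x) * (v ξ ⬝ᵥ x)) -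
          2 * ((v ξ ⬝ᵥ M *ᵥ x) * (v ξ ⬝ᵥ x)) + (M *ᵥ x) ⬝ᵥ (M *ᵥ x) := fun ξ => by
        have : vecMulVec (v ξ) (v ξ) *ᵥ x = (v ξ ⬝ᵥ x) • v ξ := by
          rw [vecMulVec_mulVec]; simp
        simp only [hZ, sub_mulVec, this, sub_dotProduct, dotProduct_sub, smul_dotProduct,
          dotProduct_smul, smul_eq_mul]
        rw [dotProduct_comm (M *ᵥ x) (v ξ)]
        ring
      have hle : ∀ᵐ ξ ∂ν, (Z ξ *ᵥ x) ⬝ᵥ (Z ξ *ᵥ x) ≤ R * ((v ξ ⬝ᵥ x) * (v ξ ⬝ᵥ x)) -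
          2 * ((v ξ ⬝ᵥ M *ᵥ x) * (v ξ ⬝ᵥ x)) + (M *ᵥ x) ⬝ᵥ (M *ᵥ x) := by
        filter_upwards [hR] with ξ hξ
        rw [hexpand]
        have := mul_le_mul_of_nonneg_right hξ (mul_self_nonneg (v ξ ⬝ᵥ x))
        linarith
      have hi1 := (hbili x x).const_mul R
      have hi2 := (hbili (M *ᵥ x) x).const_mul 2
      have hi12 : Integrable (fun ξ => R * ((v ξ ⬝ᵥ x) * (v ξ ⬝ᵥ x)) -
          2 * ((v ξ ⬝ᵥ M *ᵥ x) * (v ξ ⬝ᵥ x))) ν := hi1.sub hi2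
      calc ∫ ξ, (Z ξ *ᵥ x) ⬝ᵥ (Z ξ *ᵥ x) ∂ν
          ≤ ∫ ξ, (R * ((v ξ ⬝ᵥ x) * (v ξ ⬝ᵥ x)) -
            2 * ((v ξ ⬝ᵥ M *ᵥ x) * (v ξ ⬝ᵥ x)) + (M *ᵥ x) ⬝ᵥ (M *ᵥ x)) ∂ν :=
            integral_mono_of_nonneg (Filter.Eventually.of_forall fun ξ => hxx _)
              (hi12.add (integrable_const _)) hle
        _ = R * (x ⬝ᵥ M *ᵥ x) - (M *ᵥ x) ⬝ᵥ (M *ᵥ x) := by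
            rw [integral_add hi12 (integrable_const _), integral_sub hi1 hi2, integral_const_mul,
              integral_const_mul, hbil, hbil]
            simp; ring
        _ ≤ R * ((x ⬝ᵥ x) / N) := by
            have h1 : x ⬝ᵥ M *ᵥ x ≤ (x ⬝ᵥ x) / N := by
              rw [le_div_iff₀ hN', mul_comm]; exact hM1 x
            nlinarith [hxx (M *ᵥ x), mul_le_mul_of_nonneg_left h1 hR0.le]
        _ = R / N * (x ⬝ᵥ x) := by ring)
    (by positivity) (by rw [div_mul_cancel₀ _ hR0.ne']; exact ha1) (by linarith)
  have hsum : ∀ ω, ∑ i, Z (X i ω) = ∑ i, vecMulVec (v (X i ω)) (v (X i ω)) - N • M := fun ω => by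
    simp [hZ, Finset.sum_sub_distrib]
  simp only [hsum] at hbound
  refine hbound.trans ?_
  gcongr
  have : (N : ℝ) * ((a / R) ^ 2 * (R / N)) = a * a * R⁻¹ := by field_simp
  rw [this, div_mul_eq_mul_div, div_eq_mul_inv]
  nlinarith [mul_nonneg (mul_nonneg ha.le (sub_nonneg.mpr hau)) (inv_pos.mpr hR0).le]

end GramMatrix

/-! ### The minimum over splittings, and absorption of the prefactor. -/

section ExponentialSums

open Filter Topology

/-- As a function of `τ₁` alone the sum is continuous and tends to infinity at both ends. -/
theorem exists_isLeast_exp_add_exp {c₁ c₂ : ℝ} (h₁ : 0 < c₁) (h₂ : 0 < c₂) (t : ℝ) :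
    ∃ m, IsLeast {y : ℝ | ∃ τ₁ τ₂ : ℝ, τ₁ + τ₂ = t ∧
      y = Real.exp (-(c₁ * τ₁)) + Real.exp (-(c₂ * τ₂))} m := by
  set f : ℝ → ℝ := fun τ => Real.exp (-(c₁ * τ)) + Real.exp (-(c₂ * (t - τ))) with hf
  have hcont : Continuous f := by fun_prop
  have hbot : Tendsto f atBot atTop := by
    refine tendsto_atTop_mono (fun τ => le_add_of_nonneg_right (Real.exp_pos _).le) ?_
    refine Real.tendsto_exp_atTop.comp ?_
    simp only [← mul_neg]
    exact tendsto_neg_atBot_atTop.const_mul_atTop h₁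
  have htop : Tendsto f atTop atTop := by
    refine tendsto_atTop_mono (fun τ => le_add_of_nonneg_left (Real.exp_pos _).le) ?_
    refine Real.tendsto_exp_atTop.comp ?_
    simp only [← mul_neg, neg_sub]
    exact (tendsto_atTop_add_const_right atTop (-t) tendsto_id).const_mul_atTop h₂
  obtain ⟨τ, hτ⟩ := hcont.exists_forall_le (by
    rw [cocompact_eq_atBot_atTop]
    exact tendsto_sup.mpr ⟨hbot, htop⟩)
  refine ⟨f τ, ⟨τ, t - τ, by ring, rfl⟩, ?_⟩
  rintro y ⟨τ₁, τ₂, hsum, rfl⟩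
  have : τ₂ = t - τ₁ := by linarith
  rw [this]
  exact hτ τ₁

/-- Let `c₁ ≤ c₂`. If `τ₂ ≥ 0`, then `τ₁ ≤ t` and the first term is large enough; if `τ₂ < 0`, the
second term exceeds `1`. -/
theorem exp_neg_le_exp_add_exp {c₁ c₂ t τ₁ τ₂ : ℝ} (h₁ : 0 < c₁) (h₂ : 0 < c₂) (ht : 0 < t)
    (hsum : τ₁ + τ₂ = t) :
    Real.exp (-(min c₁ c₂ * t)) ≤ Real.exp (-(c₁ * τ₁)) + Real.exp (-(c₂ * τ₂)) := by
  wlog h : c₁ ≤ c₂ generalizing c₁ c₂ τ₁ τ₂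
  · rw [min_comm, add_comm]
    exact this h₂ h₁ (by linarith) (le_of_not_ge h)
  rw [min_eq_left h]
  rcases le_or_gt 0 τ₂ with hτ | hτ
  · refine le_add_of_le_of_nonneg (Real.exp_le_exp.mpr ?_) (Real.exp_pos _).le
    nlinarith
  · refine le_add_of_nonneg_of_le (Real.exp_pos _).le (Real.exp_le_exp.mpr ?_)
    nlinarith

/-- A constant factor in front of an exponential bound on a probability is absorbed by the
exponent. -/
theorem le_mul_of_le_mul_pow_four {p s x : ℝ} (hs : 2 ≤ s) (hx : 0 ≤ x) (hp1 : p ≤ 1)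
    (hp : p ≤ 4 * s * x ^ 4) : p ≤ s * x := by
  rcases le_or_gt 1 (s * x) with h | h
  · exact hp1.trans h
  -- Here `s ≥ 2` is essential: it forces `4 x³ ≤ 1 / 2`.
  · have hx2 : x ≤ 1 / 2 := by nlinarith
    have hx3 : x ^ 3 ≤ (1 / 2) ^ 3 := pow_le_pow_left₀ hx hx2 3
    have hsx : 0 ≤ s * x := by positivity
    nlinarith [mul_le_mul_of_nonneg_left hx3 hsx]

end ExponentialSums

/-! ### Sampling laws, coherence and the blocks of the design matrix. -/

noncomputable section

namespace BasePC

open Matrix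

variable {Ξ ι : Type*} {ψ : ι → Ξ → ℝ} {B B' : Finset ι}

theorem rowNorm_nonneg (ξ : Ξ) : 0 ≤ rowNorm ψ B ξ := Real.sqrt_nonneg _

theorem rowNorm_sq (ξ : Ξ) : rowNorm ψ B ξ ^ 2 = ∑ j ∈ B, ψ j ξ ^ 2 :=
  Real.sq_sqrt (Finset.sum_nonneg fun _ _ => sq_nonneg _)

theorem abs_le_rowNorm {j : ι} (hj : j ∈ B) (ξ : Ξ) : |ψ j ξ| ≤ rowNorm ψ B ξ :=
  Real.abs_le_sqrt (Finset.single_le_sum (f := fun j => ψ j ξ ^ 2) (fun _ _ => sq_nonneg _) hj)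

theorem optDensity_nonneg (ξ : Ξ) : 0 ≤ optDensity ψ B ξ := by
  unfold optDensity; positivity

theorem abs_weight_mul_le {j : ι} (hj : j ∈ B) (ξ : Ξ) : |weight ψ B ξ * ψ j ξ| ≤ √(B.card : ℝ) := by
  have h1 : (rowNorm ψ B ξ)⁻¹ * |ψ j ξ| ≤ 1 := by
    rw [inv_mul_eq_div]
    exact div_le_one_of_le₀ (abs_le_rowNorm hj ξ) (rowNorm_nonneg ξ)
  rw [weight, abs_mul, abs_mul, abs_of_nonneg (Real.sqrt_nonneg _), abs_inv,
    abs_of_nonneg (rowNorm_nonneg ξ), mul_assoc]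
  exact mul_le_of_le_one_right (Real.sqrt_nonneg _) h1

/-- The weight cancels the coherence-optimal density. -/
theorem weight_mul_weight_mul_optDensity {j k : ι} (hj : j ∈ B) (ξ : Ξ) :
    (weight ψ B ξ * ψ j ξ) * (weight ψ B ξ * ψ k ξ) * optDensity ψ B ξ = ψ j ξ * ψ k ξ := by
  have hcard : (B.card : ℝ) ≠ 0 := by exact_mod_cast Finset.card_ne_zero_of_mem hj
  rcases eq_or_ne (rowNorm ψ B ξ) 0 with h | h
  · have h0 : ψ j ξ = 0 := abs_nonpos_iff.mp (h ▸ abs_le_rowNorm hj ξ)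
    simp [h0]
  · have hs : √(B.card : ℝ) * √(B.card : ℝ) = B.card := Real.mul_self_sqrt (Nat.cast_nonneg _)
    unfold weight optDensity
    calc _ = (√(B.card : ℝ) * √(B.card : ℝ)) * (B.card : ℝ)⁻¹ *
          ((rowNorm ψ B ξ)⁻¹ * rowNorm ψ B ξ) ^ 2 * (ψ j ξ * ψ k ξ) := by ring
      _ = _ := by rw [hs, mul_inv_cancel₀ hcard, inv_mul_cancel₀ h]; ring

theorem corrDensity_decomposition {N₁ N₂ : ℕ} (h₂ : 0 < N₂) (ξ : Ξ) :
    N₁ * optDensity ψ B ξ + N₂ * corrDensity ψ B B' (corrRatio N₁ N₂) ξ =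
      (N₁ + N₂) * optDensity ψ B' ξ := by
  have h₂' : (0 : ℝ) < N₂ := by exact_mod_cast h₂
  have h₁' : (0 : ℝ) ≤ N₁ := Nat.cast_nonneg _
  unfold corrDensity corrRatio
  field_simp
  ring

variable [MeasurableSpace Ξ] {ρ : Measure Ξ}

theorem measurable_rowNorm (hψ : ∀ i, Measurable (ψ i)) : Measurable (rowNorm ψ B) :=
  (Finset.measurable_sum _ fun j _ => (hψ j).pow_const 2).sqrt

theorem measurable_weight (hψ : ∀ i, Measurable (ψ i)) : Measurable (weight ψ B) :=
  (measurable_rowNorm hψ).inv.const_mul _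

theorem measurable_optDensity (hψ : ∀ i, Measurable (ψ i)) : Measurable (optDensity ψ B) :=
  ((measurable_rowNorm hψ).pow_const 2).const_mul _

theorem measurable_corrDensity (hψ : ∀ i, Measurable (ψ i)) (α : ℝ) :
    Measurable (corrDensity ψ B B' α) :=
  ((measurable_optDensity hψ).sub ((measurable_optDensity hψ).const_mul _)).div_const _

/-- Integrability is implicit in orthonormality: the integral of a non-integrable `ψ_j²` would be
`0`, not `1`. -/
theorem integrable_optDensity [DecidableEq ι]
    (horth : ∀ i j, ∫ ξ, ψ i ξ * ψ j ξ ∂ρ = if i = j then 1 else 0) :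
    Integrable (optDensity ψ B) ρ := by
  unfold optDensity
  simp only [rowNorm_sq]
  refine (integrable_finsetSum _ fun j _ => ?_).const_mul _
  by_contra h
  have h1 := horth j j
  simp only [← pow_two] at h1
  rw [integral_undef h] at h1
  simp at h1

theorem integrable_corrDensity [DecidableEq ι]
    (horth : ∀ i j, ∫ ξ, ψ i ξ * ψ j ξ ∂ρ = if i = j then 1 else 0) (α : ℝ) :
    Integrable (corrDensity ψ B B' α) ρ :=
  ((integrable_optDensity horth).sub ((integrable_optDensity horth).const_mul _)).div_const _

theorem integral_samplingLaw {g : Ξ → ℝ} (hg : Measurable g) (hg0 : ∀ᵐ ξ ∂ρ, 0 ≤ g ξ) (F : Ξ → ℝ) :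
    ∫ ξ, F ξ ∂(samplingLaw ρ g) = ∫ ξ, F ξ * g ξ ∂ρ := by
  unfold samplingLaw
  rw [integral_withDensity_eq_integral_toReal_smul hg.ennreal_ofReal
    (Filter.Eventually.of_forall fun _ => ENNReal.ofReal_lt_top)]
  refine integral_congr_ae ?_
  filter_upwards [hg0] with ξ hξ
  rw [ENNReal.toReal_ofReal hξ, smul_eq_mul, mul_comm]

/-- The mixture of the two sampling laws is the law with the coherence-optimal density of the
current basis. -/
theorem integral_samplingLaw_add [DecidableEq ι] (hψ : ∀ i, Measurable (ψ i))
    (horth : ∀ i j, ∫ ξ, ψ i ξ * ψ j ξ ∂ρ = if i = j then 1 else 0) {N₁ N₂ : ℕ} (h₂ : 0 < N₂)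
    (hcorr : ∀ᵐ ξ ∂ρ, 0 ≤ corrDensity ψ B B' (corrRatio N₁ N₂) ξ) {F : Ξ → ℝ}
    (hF : Measurable F) {C : ℝ} (hC : ∀ ξ, |F ξ| ≤ C) :
    N₁ * ∫ ξ, F ξ ∂(samplingLaw ρ (optDensity ψ B)) +
      N₂ * ∫ ξ, F ξ ∂(samplingLaw ρ (corrDensity ψ B B' (corrRatio N₁ N₂))) =
      (N₁ + N₂) * ∫ ξ, F ξ * optDensity ψ B' ξ ∂ρ := by
  have hi : ∀ {g : Ξ → ℝ}, Integrable g ρ → Integrable (fun ξ => F ξ * g ξ) ρ := fun hg =>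
    hg.bdd_mul hF.aestronglyMeasurable (Filter.Eventually.of_forall hC)
  rw [integral_samplingLaw (measurable_optDensity hψ)
      (Filter.Eventually.of_forall optDensity_nonneg),
    integral_samplingLaw (measurable_corrDensity hψ _) hcorr, ← integral_const_mul,
    ← integral_const_mul, ← integral_const_mul,
    ← integral_add ((hi (integrable_optDensity horth)).const_mul _)
      ((hi (integrable_corrDensity horth _)).const_mul _)]
  refine integral_congr_ae (Filter.Eventually.of_forall fun ξ => ?_)
  have h := corrDensity_decomposition (ψ := ψ) (B := B) (B' := B') (N₁ := N₁) h₂ ξ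
  simp only
  linear_combination F ξ * h

/-- Where the row vanishes, `g ≤ 0`, and `ENNReal.ofReal` truncates it to zero. This covers both
sampling densities, each dominated by a multiple of the optimal density of `B'`. -/
theorem ae_samplingLaw_rowNorm_ne_zero {g : Ξ → ℝ} (hg : Measurable g) {c : ℝ}
    (hgc : ∀ᵐ ξ ∂ρ, g ξ ≤ c * optDensity ψ B ξ) :
    ∀ᵐ ξ ∂(samplingLaw ρ g), rowNorm ψ B ξ ≠ 0 := by
  unfold samplingLaw
  rw [ae_withDensity_iff hg.ennreal_ofReal]
  filter_upwards [hgc] with ξ hξ hne h0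
  apply hne
  rw [ENNReal.ofReal_eq_zero]
  simpa [optDensity, h0] using hξ

variable {ν : Measure Ξ}

/-- A real `essSup` is an almost sure upper bound only for an essentially bounded function; here the
bound is `|B|²`. -/
theorem ae_sum_le_coherence {S : Finset ι} {s : ℕ} (hS : S ⊆ B) (hs : S.card ≤ s) :
    ∀ᵐ ξ ∂ν, ∑ k ∈ S, |weight ψ B ξ * ψ k ξ| ^ 2 ≤ coherence ν ψ B s := by
  have hbdd : Filter.IsBoundedUnder (· ≤ ·) (ae ν)
      (fun ξ => (B.powerset.filter (fun T => T.card ≤ s)).sup' ⟨∅, by simp⟩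
        (fun T => ∑ k ∈ T, |weight ψ B ξ * ψ k ξ| ^ 2)) := by
    refine ⟨(B.card : ℝ) * √(B.card : ℝ) ^ 2, Filter.eventually_map.mpr
      (Filter.Eventually.of_forall fun ξ => Finset.sup'_le _ _ fun T hT => ?_)⟩
    have hTB : T ⊆ B := Finset.mem_powerset.mp (Finset.mem_filter.mp hT).1
    calc _ ≤ ∑ k ∈ B, |weight ψ B ξ * ψ k ξ| ^ 2 :=
          Finset.sum_le_sum_of_subset_of_nonneg hTB fun _ _ _ => by positivity
      _ ≤ ∑ _k ∈ B, √(B.card : ℝ) ^ 2 := Finset.sum_le_sum fun k hk =>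
          pow_le_pow_left₀ (abs_nonneg _) (abs_weight_mul_le hk ξ) 2
      _ = _ := by simp
  filter_upwards [ae_le_essSup hbdd] with ξ hξ
  refine le_trans ?_ hξ
  exact Finset.le_sup' (fun T => ∑ k ∈ T, |weight ψ B ξ * ψ k ξ| ^ 2)
    (Finset.mem_filter.mpr ⟨Finset.mem_powerset.mpr hS, hs⟩)

theorem coherence_pos [IsProbabilityMeasure ν] (hν : ∀ᵐ ξ ∂ν, rowNorm ψ B ξ ≠ 0) {s : ℕ}
    (hs : 1 ≤ s) : 0 < coherence ν ψ B s := by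
  have hsingle : ∀ᵐ ξ ∂ν, ∀ k ∈ B, |weight ψ B ξ * ψ k ξ| ^ 2 ≤ coherence ν ψ B s := by
    refine (Finset.eventually_all B).mpr fun k hk => ?_
    simpa using ae_sum_le_coherence (ν := ν) (ψ := ψ) (Finset.singleton_subset_iff.mpr hk)
      (by simpa using hs)
  obtain ⟨ξ, hne, hle⟩ := (hν.and hsingle).exists
  obtain ⟨k, hk, hψk⟩ : ∃ k ∈ B, ψ k ξ ≠ 0 := by
    by_contra! h
    exact hne (by rw [rowNorm, Finset.sum_eq_zero fun k hk => by simp [h k hk], Real.sqrt_zero])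
  refine lt_of_lt_of_le ?_ (hle k hk)
  have hcard : (B.card : ℝ) ≠ 0 := by exact_mod_cast Finset.card_ne_zero_of_mem hk
  have hw : weight ψ B ξ ≠ 0 :=
    mul_ne_zero ((Real.sqrt_ne_zero (Nat.cast_nonneg _)).mpr hcard) (inv_ne_zero hne)
  have := abs_pos.mpr (mul_ne_zero hw hψk)
  positivity

/-- The row of the design matrix that belongs to the sample point `ξ`. -/
def designRow (ψ : ι → Ξ → ℝ) (B S : Finset ι) (N : ℕ) (ξ : Ξ) (j : S) : ℝ :=
  (√(N : ℝ))⁻¹ * (weight ψ B ξ * ψ j ξ)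

theorem measurable_designRow (hψ : ∀ i, Measurable (ψ i)) (S : Finset ι) (N : ℕ) (j : S) :
    Measurable fun ξ => designRow ψ B S N ξ j :=
  ((measurable_weight hψ).mul (hψ j)).const_mul _

theorem abs_designRow_le {S : Finset ι} (hS : S ⊆ B) (N : ℕ) (ξ : Ξ) (j : S) :
    |designRow ψ B S N ξ j| ≤ (√(N : ℝ))⁻¹ * √(B.card : ℝ) := by
  rw [designRow, abs_mul, abs_of_nonneg (inv_nonneg.mpr (Real.sqrt_nonneg _))]
  exact mul_le_mul_of_nonneg_left (abs_weight_mul_le (hS j.2) ξ)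
    (inv_nonneg.mpr (Real.sqrt_nonneg _))

theorem designMatrix_transpose_mul_self [DecidableEq ι] (S : Finset ι) (N : ℕ) {n : ℕ}
    (x : Fin n → Ξ) : (designMatrix ψ B S N x)ᵀ * designMatrix ψ B S N x =
      ∑ i, vecMulVec (designRow ψ B S N (x i)) (designRow ψ B S N (x i)) := by
  ext j k
  simp [Matrix.mul_apply, Matrix.sum_apply, vecMulVec_apply, designMatrix, designRow]

theorem ae_designRow_dotProduct_self_le (S : Finset ι) (hS : S ⊆ B) (N : ℕ) :
    ∀ᵐ ξ ∂ν, designRow ψ B S N ξ ⬝ᵥ designRow ψ B S N ξ ≤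
      coherence ν ψ B S.card * (N : ℝ)⁻¹ := by
  filter_upwards [ae_sum_le_coherence (ν := ν) (ψ := ψ) hS le_rfl] with ξ hξ
  have h : designRow ψ B S N ξ ⬝ᵥ designRow ψ B S N ξ =
      (∑ k ∈ S, |weight ψ B ξ * ψ k ξ| ^ 2) * (N : ℝ)⁻¹ := by
    rw [← Finset.sum_coe_sort S, Finset.sum_mul]
    refine Finset.sum_congr rfl fun k _ => ?_
    rw [designRow, sq_abs, ← Real.sq_sqrt (Nat.cast_nonneg (α := ℝ) N), Real.sqrt_sq (Real.sqrt_nonneg _)]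
    ring
  rw [h]
  gcongr

variable {Ω : Type*} [MeasurableSpace Ω] {P : Measure Ω} [IsProbabilityMeasure P]

/-- The second moment matrix of a row of the design matrix. -/
def rowSecondMoment (ψ : ι → Ξ → ℝ) (B S : Finset ι) (N : ℕ) (ν : Measure Ξ) : Matrix S S ℝ :=
  Matrix.of fun j k => ∫ ξ, designRow ψ B S N ξ j * designRow ψ B S N ξ k ∂ν

/-- Concentration of one block of the design matrix. -/
theorem measureReal_lt_norm_block_sub_le [DecidableEq ι] [IsProbabilityMeasure ν]
    (hψ : ∀ i, Measurable (ψ i)) {S : Finset ι} (hS : S ⊆ B) {N n : ℕ} (hN : 0 < N)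
    (hn : 0 < n) (hnN : n ≤ N) {X : Fin n → Ω → Ξ} (hX : iIndepFun X P)
    (hlaw : ∀ i, HasLaw (X i) ν P) (hμ : 0 < coherence ν ψ B S.card)
    (hM1 : ∀ x : S → ℝ, n * (x ⬝ᵥ rowSecondMoment ψ B S N ν *ᵥ x) ≤ x ⬝ᵥ x)
    {a t : ℝ} (ha : 0 < a) (ha1 : a ≤ 1) (hat : 4 * a ≤ t) :
    P.real {ω | t / 2 < ‖(designMatrix ψ B S N fun i => X i ω)ᵀ *
        (designMatrix ψ B S N fun i => X i ω) - n • rowSecondMoment ψ B S N ν‖} ≤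
      2 * S.card * Real.exp (-(a / 4 * t * n * (coherence ν ψ B S.card)⁻¹)) := by
  have hN' : (0 : ℝ) < N := by exact_mod_cast hN
  have hnN' : (n : ℝ) ≤ N := by exact_mod_cast hnN
  have h := measureReal_lt_norm_sum_vecMulVec_sub_le (a := a) (u := t / 2) hn hX hlaw
    (measurable_designRow (B := B) hψ S N) (abs_designRow_le hS N)
    (mul_pos hμ (inv_pos.mpr hN')) (ae_designRow_dotProduct_self_le S hS N)
    (M := rowSecondMoment ψ B S N ν) (fun j k => rfl) hM1 ha ha1 (by linarith)
  simp only [designMatrix_transpose_mul_self]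
  refine h.trans ?_
  rw [Fintype.card_coe, mul_inv, inv_inv]
  refine mul_le_mul_of_nonneg_left (Real.exp_le_exp.mpr (neg_le_neg ?_)) (by positivity)
  have h1 : 0 ≤ a / 4 * t * (coherence ν ψ B S.card)⁻¹ :=
    mul_nonneg (mul_nonneg (by linarith) (by linarith)) (inv_nonneg.mpr hμ.le)
  nlinarith [mul_le_mul_of_nonneg_left hnN' h1]

theorem dotProduct_rowSecondMoment_nonneg [DecidableEq ι] (hψ : ∀ i, Measurable (ψ i)) [IsFiniteMeasure ν]
    {S : Finset ι} (hS : S ⊆ B) (N : ℕ) (x : S → ℝ) :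
    0 ≤ x ⬝ᵥ rowSecondMoment ψ B S N ν *ᵥ x := by
  have hint : ∀ j k, Integrable (fun ξ =>
      vecMulVec (designRow ψ B S N ξ) (designRow ψ B S N ξ) j k) ν := fun j k => by
    refine integrable_of_measurable_of_abs_le
      (C := ((√(N : ℝ))⁻¹ * √(B.card : ℝ)) * ((√(N : ℝ))⁻¹ * √(B.card : ℝ)))
      ((measurable_designRow hψ S N j).mul
        (measurable_designRow hψ S N k)).aemeasurable (fun ξ => ?_)
    rw [vecMulVec_apply, abs_mul]
    exact mul_le_mul (abs_designRow_le hS N ξ j) (abs_designRow_le hS N ξ k) (abs_nonneg _)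
      (by positivity)
  have h := integral_dotProduct_mulVec hint x x
  simp only [dotProduct_vecMulVec_mulVec] at h
  have e : rowSecondMoment ψ B S N ν =
      Matrix.of fun j k => ∫ ξ, vecMulVec (designRow ψ B S N ξ) (designRow ψ B S N ξ) j k ∂ν := rfl
  rw [e, ← h]
  exact integral_nonneg fun ξ => mul_self_nonneg _

/-- The design matrix of all samples is normalized. -/
theorem rowSecondMoment_add [DecidableEq ι] (hψ : ∀ i, Measurable (ψ i))
    (horth : ∀ i j, ∫ ξ, ψ i ξ * ψ j ξ ∂ρ = if i = j then 1 else 0) {S : Finset ι} (hS : S ⊆ B')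
    {N₁ N₂ : ℕ} (h₂ : 0 < N₂) (hcorr : ∀ᵐ ξ ∂ρ, 0 ≤ corrDensity ψ B B' (corrRatio N₁ N₂) ξ) :
    N₁ • rowSecondMoment ψ B' S (N₁ + N₂) (samplingLaw ρ (optDensity ψ B)) +
      N₂ • rowSecondMoment ψ B' S (N₁ + N₂)
        (samplingLaw ρ (corrDensity ψ B B' (corrRatio N₁ N₂))) = 1 := by
  ext j k
  have hN : (0 : ℝ) < ((N₁ + N₂ : ℕ) : ℝ) := by exact_mod_cast Nat.add_pos_right N₁ h₂
  have h := integral_samplingLaw_add (B := B) hψ horth h₂ hcorr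
    (F := fun ξ => designRow ψ B' S (N₁ + N₂) ξ j * designRow ψ B' S (N₁ + N₂) ξ k)
    ((measurable_designRow hψ S _ j).mul (measurable_designRow hψ S _ k))
    (C := ((√((N₁ + N₂ : ℕ) : ℝ))⁻¹ * √(B'.card : ℝ)) * ((√((N₁ + N₂ : ℕ) : ℝ))⁻¹ * √(B'.card : ℝ)))
    (fun ξ => by
      rw [abs_mul]
      exact mul_le_mul (abs_designRow_le hS _ ξ j) (abs_designRow_le hS _ ξ k) (abs_nonneg _)
        (by positivity))
  have hpt : ∀ ξ, designRow ψ B' S (N₁ + N₂) ξ j * designRow ψ B' S (N₁ + N₂) ξ k *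
      optDensity ψ B' ξ = ((N₁ + N₂ : ℕ) : ℝ)⁻¹ * (ψ j ξ * ψ k ξ) := fun ξ => by
    have hsq : (√((N₁ + N₂ : ℕ) : ℝ))⁻¹ * (√((N₁ + N₂ : ℕ) : ℝ))⁻¹ = ((N₁ + N₂ : ℕ) : ℝ)⁻¹ := by
      rw [← mul_inv, Real.mul_self_sqrt hN.le]
    rw [← weight_mul_weight_mul_optDensity (hS j.2) ξ, ← hsq, designRow, designRow]
    ring
  simp only [hpt] at h
  rw [integral_const_mul, horth, ← Nat.cast_add, mul_inv_cancel_left₀ hN.ne'] at h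
  rw [Matrix.add_apply, Matrix.smul_apply, Matrix.smul_apply, nsmul_eq_mul, nsmul_eq_mul,
    Matrix.one_apply]
  simpa only [rowSecondMoment, Matrix.of_apply, Subtype.ext_iff] using h

/-- Dropping the positive semidefinite second block leaves the bound on the first that the variance
estimate needs. -/
theorem card_mul_dotProduct_rowSecondMoment_le {m : Type*} [Fintype m] [DecidableEq m]
    {N₁ N₂ : ℕ} {M₁ M₂ : Matrix m m ℝ} (h : N₁ • M₁ + N₂ • M₂ = 1)
    (hM₂ : ∀ x : m → ℝ, 0 ≤ x ⬝ᵥ M₂ *ᵥ x) (x : m → ℝ) : N₁ * (x ⬝ᵥ M₁ *ᵥ x) ≤ x ⬝ᵥ x := by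
  have e : x ⬝ᵥ (N₁ • M₁ + N₂ • M₂) *ᵥ x = N₁ * (x ⬝ᵥ M₁ *ᵥ x) + N₂ * (x ⬝ᵥ M₂ *ᵥ x) := by
    rw [← Nat.cast_smul_eq_nsmul ℝ, ← Nat.cast_smul_eq_nsmul ℝ, add_mulVec, dotProduct_add,
      smul_mulVec, smul_mulVec, dotProduct_smul, dotProduct_smul, smul_eq_mul, smul_eq_mul]
  rw [h, one_mulVec] at e
  have := mul_nonneg (Nat.cast_nonneg (α := ℝ) N₂) (hM₂ x)
  linarith

end BasePC

end

/-! ### The main theorem. -/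

theorem mainTheorem7 (t₀ : ℝ) (ht₀ : 0 < t₀) :
    ∃ κ : ℝ → ℝ, (∀ r, 0 < κ r) ∧
    ∀ (Ξ : Type*) [MeasurableSpace Ξ] (ρ : Measure Ξ) [IsProbabilityMeasure ρ]
      (ι : Type*) [DecidableEq ι] (ψ : ι → Ξ → ℝ)
      (_ : ∀ i, Measurable (ψ i))
      (_ : ∀ i j, ∫ ξ, ψ i ξ * ψ j ξ ∂ρ = if i = j then 1 else 0)
      -- the previous basis, the current basis, and a set of columns
      (B B' S : Finset ι) (_ : S ⊆ B') (_ : 2 ≤ S.card)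
      (N₁ N₂ : ℕ) (_ : 0 < N₁) (_ : 0 < N₂)
      -- the correction density is nonnegative
      (_ : ∀ᵐ ξ ∂ρ, 0 ≤ BasePC.corrDensity ψ B B' (BasePC.corrRatio N₁ N₂) ξ)
      (Ω : Type*) [MeasurableSpace Ω] (P : Measure Ω) [IsProbabilityMeasure P]
      -- the original samples and the correction samples
      (X₁ : Fin N₁ → Ω → Ξ) (X₂ : Fin N₂ → Ω → Ξ)
      (_ : ∀ i, HasLaw (X₁ i) (BasePC.samplingLaw ρ (BasePC.optDensity ψ B)) P)
      (_ : ∀ i, HasLaw (X₂ i)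
        (BasePC.samplingLaw ρ (BasePC.corrDensity ψ B B' (BasePC.corrRatio N₁ N₂))) P)
      (_ : iIndepFun X₁ P) (_ : iIndepFun X₂ P)
      (t : ℝ) (_ : t₀ ≤ t),
      let D₁ : Ω → Matrix (Fin N₁) S ℝ := fun ω =>
        BasePC.designMatrix ψ B' S (N₁ + N₂) (fun i => X₁ i ω)
      let D₂ : Ω → Matrix (Fin N₂) S ℝ := fun ω =>
        BasePC.designMatrix ψ B' S (N₁ + N₂) (fun i => X₂ i ω)
      let D : Ω → Matrix (Fin N₁ ⊕ Fin N₂) S ℝ := fun ω => Matrix.fromRows (D₁ ω) (D₂ ω)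
      let E₁ : Matrix S S ℝ := BasePC.expectation P (fun ω => (D₁ ω)ᵀ * D₁ ω)
      let E₂ : Matrix S S ℝ := BasePC.expectation P (fun ω => (D₂ ω)ᵀ * D₂ ω)
      let κ₁ : ℝ := κ (‖E₁‖ ^ (-(1 / 2) : ℝ))
      let κ₂ : ℝ := κ (‖E₂‖ ^ (-(1 / 2) : ℝ))
      let μ₁ : ℝ := BasePC.coherence
        (BasePC.samplingLaw ρ (BasePC.optDensity ψ B)) ψ B' S.card
      let μ₂ : ℝ := BasePC.coherence
        (BasePC.samplingLaw ρ (BasePC.corrDensity ψ B B' (BasePC.corrRatio N₁ N₂)))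
        ψ B' S.card
      ∃ m : ℝ,
        IsLeast {y : ℝ | ∃ τ₁ τ₂ : ℝ, τ₁ + τ₂ = t ∧
          y = Real.exp (-(κ₁ * τ₁ * N₁ * μ₁⁻¹)) + Real.exp (-(κ₂ * τ₂ * N₂ * μ₂⁻¹))} m ∧
        P.real {ω | t < ‖(D ω)ᵀ * D ω - 1‖} ≤ (S.card : ℝ) * m := by
  -- `a ≤ 1` keeps the exponential estimate valid, and `4 a ≤ t` makes the deviation `t / 2` of each
  -- block at least `2 a`.
  set a : ℝ := min 1 (t₀ / 4) with ha
  have ha0 : 0 < a := lt_min one_pos (by linarith)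
  have ha1 : a ≤ 1 := min_le_left _ _
  have hat : 4 * a ≤ t₀ := by linarith [min_le_right 1 (t₀ / 4)]
  -- The block bound has rate `a / 4`; a quarter of it is kept and the rest absorbs the prefactor.
  refine ⟨fun _ => a / 16, fun _ => by positivity, ?_⟩
  intro Ξ _ ρ _ ι _ ψ hψ horth B B' S hS hS2 N₁ N₂ hN₁ hN₂ hcorr Ω _ P _ X₁ X₂ hX₁ hX₂ hind₁ hind₂ t ht
    D₁ D₂ D E₁ E₂ κ₁ κ₂ μ₁ μ₂
  have ht0 : 0 < t := ht₀.trans_le ht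
  have hN₁' : (0 : ℝ) < N₁ := by exact_mod_cast hN₁
  have hN₂' : (0 : ℝ) < N₂ := by exact_mod_cast hN₂
  set ν₁ := BasePC.samplingLaw ρ (BasePC.optDensity ψ B) with hν₁
  set ν₂ := BasePC.samplingLaw ρ
    (BasePC.corrDensity ψ B B' (BasePC.corrRatio N₁ N₂)) with hν₂
  -- Normalization of the densities is read off from the existence of a sample with that law.
  have : IsProbabilityMeasure ν₁ := (hX₁ ⟨0, hN₁⟩).isProbabilityMeasure_iff.mp inferInstance
  have : IsProbabilityMeasure ν₂ := (hX₂ ⟨0, hN₂⟩).isProbabilityMeasure_iff.mp inferInstance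
  have hne₁ : ∀ᵐ ξ ∂ν₁, BasePC.rowNorm ψ B' ξ ≠ 0 := by
    refine BasePC.ae_samplingLaw_rowNorm_ne_zero (c := (N₁ + N₂) / N₁)
      (BasePC.measurable_optDensity hψ) ?_
    filter_upwards [hcorr] with ξ hξ
    have h := BasePC.corrDensity_decomposition (ψ := ψ) (B := B) (B' := B') (N₁ := N₁) hN₂ ξ
    rw [div_mul_eq_mul_div, ← h, le_div_iff₀ hN₁']
    linarith [mul_nonneg hN₂'.le hξ]
  have hne₂ : ∀ᵐ ξ ∂ν₂, BasePC.rowNorm ψ B' ξ ≠ 0 := by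
    refine BasePC.ae_samplingLaw_rowNorm_ne_zero (c := (N₁ + N₂) / N₂)
      (BasePC.measurable_corrDensity hψ _) (Filter.Eventually.of_forall fun ξ => ?_)
    have h := BasePC.corrDensity_decomposition (ψ := ψ) (B := B) (B' := B') (N₁ := N₁) hN₂ ξ
    rw [div_mul_eq_mul_div, ← h, le_div_iff₀ hN₂']
    linarith [mul_nonneg hN₁'.le (BasePC.optDensity_nonneg (ψ := ψ) (B := B) ξ)]
  have hμ₁ : 0 < μ₁ := BasePC.coherence_pos hne₁ (by omega)
  have hμ₂ : 0 < μ₂ := BasePC.coherence_pos hne₂ (by omega)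
  set M₁ := BasePC.rowSecondMoment ψ B' S (N₁ + N₂) ν₁ with hM₁
  set M₂ := BasePC.rowSecondMoment ψ B' S (N₁ + N₂) ν₂ with hM₂
  have hM : N₁ • M₁ + N₂ • M₂ = 1 := BasePC.rowSecondMoment_add hψ horth hS hN₂ hcorr
  have hblock₁ := BasePC.measureReal_lt_norm_block_sub_le hψ hS (Nat.add_pos_left hN₁ N₂) hN₁
    (Nat.le_add_right N₁ N₂) hind₁ hX₁ hμ₁
    (BasePC.card_mul_dotProduct_rowSecondMoment_le hM
      (BasePC.dotProduct_rowSecondMoment_nonneg hψ hS _)) ha0 ha1 (hat.trans ht)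
  have hblock₂ := BasePC.measureReal_lt_norm_block_sub_le hψ hS (Nat.add_pos_left hN₁ N₂) hN₂
    (Nat.le_add_left N₂ N₁) hind₂ hX₂ hμ₂
    (BasePC.card_mul_dotProduct_rowSecondMoment_le (by rw [add_comm]; exact hM)
      (BasePC.dotProduct_rowSecondMoment_nonneg hψ hS _)) ha0 ha1 (hat.trans ht)
  set c₁ : ℝ := a / 16 * N₁ * μ₁⁻¹ with hc₁
  set c₂ : ℝ := a / 16 * N₂ * μ₂⁻¹ with hc₂
  have hc₁0 : 0 < c₁ := by positivity
  have hc₂0 : 0 < c₂ := by positivity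
  obtain ⟨m, hm⟩ := exists_isLeast_exp_add_exp hc₁0 hc₂0 t
  have e₁ : ∀ τ : ℝ, κ₁ * τ * N₁ * μ₁⁻¹ = c₁ * τ := fun τ => by
    change a / 16 * τ * N₁ * μ₁⁻¹ = c₁ * τ
    rw [hc₁]; ring
  have e₂ : ∀ τ : ℝ, κ₂ * τ * N₂ * μ₂⁻¹ = c₂ * τ := fun τ => by
    change a / 16 * τ * N₂ * μ₂⁻¹ = c₂ * τ
    rw [hc₂]; ring
  refine ⟨m, by simpa only [e₁, e₂] using hm, ?_⟩
  -- The deviation is always halved, whatever the optimal `τ₁, τ₂`. The union bound requires no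
  -- independence between the two groups.
  have hsub : {ω | t < ‖(D ω)ᵀ * D ω - 1‖} ⊆
      {ω | t / 2 < ‖(D₁ ω)ᵀ * D₁ ω - N₁ • M₁‖} ∪ {ω | t / 2 < ‖(D₂ ω)ᵀ * D₂ ω - N₂ • M₂‖} := by
    intro ω hω
    by_contra hcon
    simp only [Set.mem_union, Set.mem_ofPred_eq, not_or, not_lt] at hcon hω
    have hsplit : (D ω)ᵀ * D ω - 1 =
        ((D₁ ω)ᵀ * D₁ ω - N₁ • M₁) + ((D₂ ω)ᵀ * D₂ ω - N₂ • M₂) := by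
      rw [← hM]
      simp only [D, Matrix.transpose_fromRows, Matrix.fromCols_mul_fromRows]
      abel
    rw [hsplit] at hω
    linarith [norm_add_le ((D₁ ω)ᵀ * D₁ ω - N₁ • M₁) ((D₂ ω)ᵀ * D₂ ω - N₂ • M₂)]
  set x : ℝ := Real.exp (-(min c₁ c₂ * t)) with hx
  have hx4 : ∀ c : ℝ, min c₁ c₂ ≤ c → Real.exp (-(4 * c * t)) ≤ x ^ 4 := fun c hc => by
    rw [hx, ← Real.exp_nat_mul]
    refine Real.exp_le_exp.mpr ?_
    push_cast
    linarith [mul_le_mul_of_nonneg_right hc ht0.le]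
  have hp : P.real {ω | t < ‖(D ω)ᵀ * D ω - 1‖} ≤ 4 * S.card * x ^ 4 := by
    refine (measureReal_mono hsub).trans ((measureReal_union_le _ _).trans
      ((add_le_add hblock₁ hblock₂).trans ?_))
    have h₁ := hx4 c₁ (min_le_left _ _)
    have h₂ := hx4 c₂ (min_le_right _ _)
    have f₁ : a / 4 * t * N₁ * μ₁⁻¹ = 4 * c₁ * t := by rw [hc₁]; ring
    have f₂ : a / 4 * t * N₂ * μ₂⁻¹ = 4 * c₂ * t := by rw [hc₂]; ring
    change 2 * (S.card : ℝ) * Real.exp (-(a / 4 * t * N₁ * μ₁⁻¹)) +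
      2 * (S.card : ℝ) * Real.exp (-(a / 4 * t * N₂ * μ₂⁻¹)) ≤ _
    rw [f₁, f₂]
    have hs : (0 : ℝ) ≤ S.card := Nat.cast_nonneg _
    linarith [mul_le_mul_of_nonneg_left h₁ hs, mul_le_mul_of_nonneg_left h₂ hs]
  refine (le_mul_of_le_mul_pow_four (by exact_mod_cast hS2) (Real.exp_pos _).le
    measureReal_le_one hp).trans ?_
  refine mul_le_mul_of_nonneg_left ?_ (Nat.cast_nonneg _)
  obtain ⟨τ₁, τ₂, hsum, hmeq⟩ := hm.1
  rw [hmeq]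
  exact exp_neg_le_exp_add_exp hc₁0 hc₂0 ht0 hsum
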